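/- Let $(M,g)$ be a connected smooth Riemannian manifold of dimension $n$, let $f\in C^\infty(M)$ with $f>0$, and let $p,q\ge 0$. Let $\pi:T^p_q(M)\to M$ be the bundle of $(p,q)$-tensors. Write $\nabla$ for the Levi-Civita connection of $g$, $\Gamma^k_{ij}$ for its coefficients, $R(X,Y)=[\nabla_X,\nabla_Y]-\nabla_{[X,Y]}$ for its curvature, and $R(\partial_l,\partial_j)\partial_k=R_{ljk}{}^{s}\,\partial_s$. In the coordinates $(x^j,t^{i_1\dots i_p}_{j_1\dots j_q})$ induced on $T^p_q(M)$ by a chart of $M$, the vertical lift ${}^VA$ of a $(p,q)$-tensor $A$ has components $(0,A^{i_1\dots i_p}_{j_1\dots j_q})$, and the horizontal lift ${}^HX$ of a vector $X$ has components $$\Bigl(X^j,\;X^s\Bigl(\sum_{\mu=1}^q\Gamma^m_{sj_\mu}t^{i_1\dots i_p}_{j_1\dots m\dots j_q}-\sum_{\lambda=1}^p\Gamma^{i_\lambda}_{sm}t^{i_1\dots m\dots i_p}_{j_1\dots j_q}\Bigr)\Bigr).$$ The rescaled Sasaki type metric ${}^Sg_f$ on $T^p_q(M)$ is given by $${}^Sg_f({}^HX,{}^HY)=f\,g(X,Y),\qquad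 {}^Sg_f({}^VA,{}^HY)=0,\qquad {}^Sg_f({}^VA,{}^VB)=g_{i_1k_1}\cdots g_{i_pk_p}\,g^{j_1l_1}\cdots g^{j_ql_q}A^{i_1\dots i_p}_{j_1\dots j_q}B^{k_1\dots k_p}_{l_1\dots l_q}.$$ Let ${}^{(M)}\widehat\nabla$ be the metric connection of ${}^Sg_f$ whose torsion tensor at a point $t\in T^p_q(M)$ vanishes as soon as one argument is vertical and satisfies $$T({}^H\partial_l,{}^H\partial_j)={}^V\Bigl(\sum_{\lambda=1}^pR_{ljm}{}^{i_\lambda}\,t^{i_1\dots m\dots i_p}_{j_1\dots j_q}-\sum_{\mu=1}^qR_{ljj_\mu}{}^{m}\,t^{i_1\dots i_p}_{j_1\dots m\dots j_q}\Bigr).$$ A geodesic of a connection is a $C^2$ curve $c$, defined on an open interval, whose velocity is parallel along $c$. Then: 1. For every geodesic $\widetilde\gamma$ of ${}^{(M)}\widehat\nabla$ in $T^p_q(M)$, with projection $\gamma=\pi\circ\widetilde\gamma$, the tensor field $t^{v_1\dots v_p}_{r_1\dots r_q}(s)$ along $\gamma$ defined by $\widetilde\gamma$ has vanishing second covariant derivative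 (with respect to $\nabla$) along $\gamma$: $\dfrac{\delta^2t^{v_1\dots v_p}_{r_1\dots r_q}}{ds^2}=0$. 2. The projection $\gamma=\pi\circ\widetilde\gamma$ of every geodesic $\widetilde\gamma$ of ${}^{(M)}\widehat\nabla$ is a geodesic of the Levi-Civita connection $\nabla$ of $(M,g)$ if and only if $f$ is constant. 3. The equivalence in 2 also holds when "every geodesic $\widetilde\gamma$" is restricted to the geodesics $\widetilde\gamma$ that are parametrized by arc length with respect to ${}^Sg_f$. -/

import Mathlib

open scoped Manifold ContDiff

noncomputable section

namespace RescaledSasaki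

/-! ### Metrics and Christoffel symbols in a coordinate domain -/

section Coordinates

variable {κ : Type*} [Fintype κ] [DecidableEq κ]

/-- The partial derivative `∂_a F` at `z` of a function of the coordinates indexed by `κ`. -/
def pd (a : κ) (F : (κ → ℝ) → ℝ) (z : κ → ℝ) : ℝ :=
  fderiv ℝ F z (Pi.single a 1)

/-- The Christoffel symbol `Γ^c_{ab}` at `z` of the Levi-Civita connection of the metric whose
matrix of components in the coordinates is `G`:
`Γ^c_{ab} = (1/2) G^{cd} (∂_a G_{bd} + ∂_b G_{ad} - ∂_d G_{ab})`. -/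
def christoffel (G : (κ → ℝ) → Matrix κ κ ℝ) (z : κ → ℝ) (c a b : κ) : ℝ :=
  (1 / 2) * ∑ d, (G z)⁻¹ c d *
    (pd a (fun w => G w b d) z + pd b (fun w => G w a d) z - pd d (fun w => G w a b) z)

/-- The component `R_{ljk}^s` of the curvature tensor `R(X,Y) = [∇_X,∇_Y] - ∇_{[X,Y]}` of the
connection with Christoffel symbols `Γ z s j k = Γ^s_{jk}(z)`, that is
`R(∂_l,∂_j)∂_k = R_{ljk}^s ∂_s`. -/
def curvature (Γ : (κ → ℝ) → κ → κ → κ → ℝ) (z : κ → ℝ) (l j k s : κ) : ℝ :=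
  pd l (fun w => Γ w s j k) z - pd j (fun w => Γ w s l k) z
    + ∑ m, (Γ z s l m * Γ z m j k - Γ z s j m * Γ z m l k)

/-- The contorsion `U^c_{ab}` of the torsion `T^c_{ab} = T z c a b` with respect to the metric `G`:
lowering the upper index to the last place,
`U_{abc} = (1/2) (T_{abc} + T_{cab} + T_{cba})`. -/
def contorsion (G : (κ → ℝ) → Matrix κ κ ℝ) (T : (κ → ℝ) → κ → κ → κ → ℝ)
    (z : κ → ℝ) (c a b : κ) : ℝ :=
  let low : κ → κ → κ → ℝ := fun a b d => ∑ e, T z e a b * G z e d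
  ∑ d, (1 / 2) * (low a b d + low d a b + low d b a) * (G z)⁻¹ d c

/-- The connection coefficients `Γ^c_{ab}`, with `∇_{∂_a} ∂_b = Γ^c_{ab} ∂_c`, of the metric
connection of `G` with torsion `T` (Levi-Civita connection plus contorsion). -/
def metricConnection (G : (κ → ℝ) → Matrix κ κ ℝ) (T : (κ → ℝ) → κ → κ → κ → ℝ)
    (z : κ → ℝ) (c a b : κ) : ℝ :=
  christoffel G z c a b + contorsion G T z c a b

/-- Coordinate form of `∇_{c'} c' = 0` at the parameter `t`, for a curve `X` in the coordinate
domain and a connection with coefficients `Γ z c a b = Γ^c_{ab}(z)`. -/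
def GeodesicEquation (Γ : (κ → ℝ) → κ → κ → κ → ℝ) (X : ℝ → κ → ℝ) (t : ℝ) : Prop :=
  ∀ c, deriv (fun r => deriv (fun s => X s c) r) t
    + ∑ a, ∑ b, Γ (X t) c a b * deriv (fun s => X s a) t * deriv (fun s => X s b) t = 0

end Coordinates

section Facts

variable {κ : Type*} [Fintype κ] [DecidableEq κ]

theorem sum_christoffel_mul (G : (κ → ℝ) → Matrix κ κ ℝ) (hG : ∀ w, (G w).IsSymm)
    (z : κ → ℝ) (hz : IsUnit (G z).det) (a b d : κ) :
    ∑ c, christoffel G z c a b * G z c d = (1 / 2) *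
      (pd a (fun w => G w b d) z + pd b (fun w => G w a d) z - pd d (fun w => G w a b) z) := by
  have h1 : ∀ r, ∑ c, (G z)⁻¹ c r * G z c d = if r = d then 1 else 0 := by
    intro r
    have := congrFun (congrFun (Matrix.mul_nonsing_inv (G z) hz) d) r
    rw [Matrix.mul_apply, Matrix.one_apply] at this
    rw [show (if r = d then (1 : ℝ) else 0) = if d = r then 1 else 0 by simp [eq_comm], ← this]
    refine Finset.sum_congr rfl fun c _ => ?_
    rw [mul_comm, (hG z).apply]
  simp only [christoffel, Finset.mul_sum, Finset.sum_mul]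
  rw [Finset.sum_comm]
  have h2 : ∀ r, ∑ c, 1 / 2 * ((G z)⁻¹ c r * (pd a (fun w => G w b r) z
      + pd b (fun w => G w a r) z - pd r (fun w => G w a b) z)) * G z c d
      = (∑ c, (G z)⁻¹ c r * G z c d) * (1 / 2 * (pd a (fun w => G w b r) z
      + pd b (fun w => G w a r) z - pd r (fun w => G w a b) z)) := by
    intro r
    rw [Finset.sum_mul]
    exact Finset.sum_congr rfl fun c _ => by ring
  simp only [mul_assoc] at h2 ⊢
  simp only [h2, h1]
  simp

theorem sum_contorsion_mul (G : (κ → ℝ) → Matrix κ κ ℝ) (T : (κ → ℝ) → κ → κ → κ → ℝ)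
    (z : κ → ℝ) (hz : IsUnit (G z).det) (a b d : κ) :
    ∑ c, contorsion G T z c a b * G z c d = (1 / 2) *
      (∑ e, T z e a b * G z e d + ∑ e, T z e d a * G z e b + ∑ e, T z e d b * G z e a) := by
  have h1 : ∀ r, ∑ c, (G z)⁻¹ r c * G z c d = if r = d then 1 else 0 := by
    intro r
    have := congrFun (congrFun (Matrix.nonsing_inv_mul (G z) hz) r) d
    rwa [Matrix.mul_apply, Matrix.one_apply] at this
  simp only [contorsion, Finset.sum_mul]
  rw [Finset.sum_comm]
  simp only [mul_assoc, ← Finset.mul_sum, h1]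
  simp

/-- `metricConnection G T` is a metric connection: `∇G = 0`. -/
theorem metricConnection_metric (G : (κ → ℝ) → Matrix κ κ ℝ) (hG : ∀ w, (G w).IsSymm)
    (T : (κ → ℝ) → κ → κ → κ → ℝ) (hT : ∀ w c a b, T w c a b = - T w c b a)
    (z : κ → ℝ) (hz : IsUnit (G z).det) (a b d : κ) :
    pd a (fun w => G w b d) z - ∑ c, metricConnection G T z c a b * G z c d
      - ∑ c, metricConnection G T z c a d * G z b c = 0 := by
  have hs : ∀ r s, (fun w => G w r s) = fun w => G w s r := fun r s =>
    funext fun w => (hG w).apply s r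
  simp only [metricConnection, add_mul, Finset.sum_add_distrib, ← (hG z).apply b,
    sum_christoffel_mul G hG z hz, sum_contorsion_mul G T z hz]
  have e : ∀ r s u, ∑ e, T z e r s * G z e u = - ∑ e, T z e s r * G z e u := fun r s u => by
    rw [← Finset.sum_neg_distrib]
    exact Finset.sum_congr rfl fun k _ => by rw [hT z k r s]; ring
  rw [hs d b, e d b a, e d a b, e b a d]
  ring

/-- The torsion of `metricConnection G T` is `T`. -/
theorem metricConnection_torsion (G : (κ → ℝ) → Matrix κ κ ℝ) (hG : ∀ w, (G w).IsSymm)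
    (T : (κ → ℝ) → κ → κ → κ → ℝ) (hT : ∀ w c a b, T w c a b = - T w c b a)
    (z : κ → ℝ) (hz : IsUnit (G z).det) (c a b : κ) :
    metricConnection G T z c a b - metricConnection G T z c b a = T z c a b := by
  have hs : ∀ r s, (fun w => G w r s) = fun w => G w s r := fun r s =>
    funext fun w => (hG w).apply s r
  have e : ∀ r s u, ∑ e, T z e r s * G z e u = - ∑ e, T z e s r * G z e u := fun r s u => by
    rw [← Finset.sum_neg_distrib]
    exact Finset.sum_congr rfl fun k _ => by rw [hT z k r s]; ring
  have key : Matrix.vecMul (fun c => metricConnection G T z c a b - metricConnection G T z c b a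
      - T z c a b) (G z) = 0 := by
    funext d
    simp only [Matrix.vecMul, dotProduct, sub_mul, Finset.sum_sub_distrib, metricConnection,
      add_mul, Finset.sum_add_distrib, sum_christoffel_mul G hG z hz,
      sum_contorsion_mul G T z hz, Pi.zero_apply]
    rw [hs b a, e b a d]
    ring
  have h := congrArg (fun v => Matrix.vecMul v (G z)⁻¹) key
  simp only [Matrix.vecMul_vecMul, Matrix.mul_nonsing_inv _ hz, Matrix.vecMul_one,
    Matrix.zero_vecMul] at h
  have := congrFun h c
  simp only [Pi.zero_apply] at this
  linarith

end Facts

/-! ### The base manifold -/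

/-- A Riemannian metric of class `C^∞` on an `n`-dimensional manifold `M`. -/
abbrev Metric (n : ℕ) (M : Type*) [TopologicalSpace M] [ChartedSpace (EuclideanSpace ℝ (Fin n)) M]
    [IsManifold (𝓡 n) ∞ M] :=
  Bundle.ContMDiffRiemannianMetric (𝓡 n) ∞ (EuclideanSpace ℝ (Fin n))
    (fun x : M => TangentSpace (𝓡 n) x)

/-- Tensors of type `(p,q)` over a real vector space: multilinear in `p` covectors and in `q`
vectors. -/
abbrev Tensor (p q : ℕ) (V : Type*) [AddCommGroup V] [Module ℝ V] :=
  MultilinearMap ℝ (fun _ : Fin p => Module.Dual ℝ V)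
    (MultilinearMap ℝ (fun _ : Fin q => V) ℝ)

/-- Families of components `A^{i_1 … i_p}_{j_1 … j_q}`, written `A i j`. -/
abbrev Components (n p q : ℕ) := (Fin p → Fin n) → (Fin q → Fin n) → ℝ

/-- Index set of the `n + n^{p+q}` coordinates `(x^j, t^{i_1 … i_p}_{j_1 … j_q})` of the tensor
bundle. -/
abbrev Idx (n p q : ℕ) := Fin n ⊕ ((Fin p → Fin n) × (Fin q → Fin n))

section Manifold

variable {n : ℕ} {M : Type*} [TopologicalSpace M] [ChartedSpace (EuclideanSpace ℝ (Fin n)) M]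

/-- The tensor bundle `T^p_q(M)`, the disjoint union of the tensor spaces `T^p_q(x)`, `x ∈ M`; the
projection onto `M` is the first component. -/
def TensorBundle (n : ℕ) (M : Type*) [TopologicalSpace M]
    [ChartedSpace (EuclideanSpace ℝ (Fin n)) M] (p q : ℕ) :=
  Σ x : M, Tensor p q (TangentSpace (𝓡 n) x)

/-- The natural projection `T^p_q(M) → M`. -/
def proj {p q : ℕ} (P : TensorBundle n M p q) : M := P.1

/-- The coordinate vector `∂_i` of the chart `e` at the point `y` of its domain. -/
def frame (e : OpenPartialHomeomorph M (EuclideanSpace ℝ (Fin n))) (y : M) (i : Fin n) :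
    TangentSpace (𝓡 n) y :=
  mfderiv (𝓡 n) (𝓡 n) e.symm (e y) (EuclideanSpace.single i (1 : ℝ))

/-- The coordinate covector `dx^i` of the chart `e` at the point `y` of its domain. -/
def coframe (e : OpenPartialHomeomorph M (EuclideanSpace ℝ (Fin n))) (y : M) (i : Fin n) :
    Module.Dual ℝ (TangentSpace (𝓡 n) y) :=
  ((EuclideanSpace.proj i : EuclideanSpace ℝ (Fin n) →L[ℝ] ℝ).comp
    (mfderiv (𝓡 n) (𝓡 n) e y : TangentSpace (𝓡 n) y →L[ℝ] EuclideanSpace ℝ (Fin n))).toLinearMap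

/-- The coordinates `x^i` of a point of `M` in the chart `e`. -/
def coord (e : OpenPartialHomeomorph M (EuclideanSpace ℝ (Fin n))) (y : M) : Fin n → ℝ :=
  fun i => e y i

/-- The point of `M` with coordinates `x` in the chart `e`. -/
def point (e : OpenPartialHomeomorph M (EuclideanSpace ℝ (Fin n))) (x : Fin n → ℝ) : M :=
  e.symm (WithLp.toLp 2 x)

/-- The components of the tensor `P.2` at `P.1` in the natural base of the chart `e`. -/
def components {p q : ℕ} (e : OpenPartialHomeomorph M (EuclideanSpace ℝ (Fin n)))
    (P : TensorBundle n M p q) : Components n p q :=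
  fun i j => P.2 (fun a => coframe e P.1 (i a)) (fun b => frame e P.1 (j b))

/-- The coordinates `(x^j, t^{i_1 … i_p}_{j_1 … j_q})` on the tensor bundle induced by the
chart `e`. -/
def bundleCoord {p q : ℕ} (e : OpenPartialHomeomorph M (EuclideanSpace ℝ (Fin n)))
    (P : TensorBundle n M p q) : Idx n p q → ℝ :=
  Sum.elim (coord e P.1) (fun ij => components e P ij.1 ij.2)

/-- Base part `x` of a point `(x,t)`, or of a tangent vector, in induced coordinates. -/
def basePart {p q : ℕ} (z : Idx n p q → ℝ) : Fin n → ℝ := fun i => z (Sum.inl i)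

/-- Fibre part `t` of a point `(x,t)`, or of a tangent vector, in induced coordinates. -/
def fibrePart {p q : ℕ} (z : Idx n p q → ℝ) : Components n p q := fun i j => z (Sum.inr (i, j))

/-- The pair `(x,t)` in induced coordinates. -/
def mkIdx {p q : ℕ} (x : Fin n → ℝ) (A : Components n p q) : Idx n p q → ℝ :=
  Sum.elim x (fun ij => A ij.1 ij.2)

/-- `∑_λ φ_m^{i_λ} A^{i_1 … m … i_p}_{j_1 … j_q} - ∑_μ φ_{j_μ}^m A^{i_1 … i_p}_{j_1 … m … j_q}`,
the action on `(p,q)`-components of an endomorphism with components `φ k m = φ_m^k`. -/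
def act {p q : ℕ} (φ : Fin n → Fin n → ℝ) (A : Components n p q) : Components n p q :=
  fun i j => ∑ a, ∑ m, φ (i a) m * A (Function.update i a m) j
    - ∑ b, ∑ m, φ m (j b) * A i (Function.update j b m)

variable [IsManifold (𝓡 n) ∞ M]

/-- The components `g_{ij}` of the metric in the chart `e`. -/
def metricMatrix (g : Metric n M) (e : OpenPartialHomeomorph M (EuclideanSpace ℝ (Fin n)))
    (x : Fin n → ℝ) : Matrix (Fin n) (Fin n) ℝ :=
  fun i j => g.inner (point e x) (frame e (point e x) i) (frame e (point e x) j)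

/-- The Christoffel symbols `Γ^k_{ij}` of the Levi-Civita connection `∇` of `g` in the chart `e`. -/
def baseChristoffel (g : Metric n M) (e : OpenPartialHomeomorph M (EuclideanSpace ℝ (Fin n))) :
    (Fin n → ℝ) → Fin n → Fin n → Fin n → ℝ :=
  christoffel (metricMatrix g e)

/-- The term `∑_λ Γ^{i_λ}_{lm} ξ^l A^{… m …}_{…} - ∑_μ Γ^m_{l j_μ} ξ^l A^{…}_{… m …}` of the
covariant derivative of a `(p,q)`-tensor field in the direction `ξ` at the point `x`. -/
def connectionTerm (g : Metric n M) (e : OpenPartialHomeomorph M (EuclideanSpace ℝ (Fin n)))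
    {p q : ℕ} (x ξ : Fin n → ℝ) (A : Components n p q) : Components n p q :=
  act (fun k m => ∑ l, ξ l * baseChristoffel g e x k l m) A

/-- The covariant derivative `δA/dt`, along the curve `γ` in `M`, of a `(p,q)`-tensor field along
`γ`, given by its components `A t` in the chart `e`. -/
def covDeriv (g : Metric n M) (e : OpenPartialHomeomorph M (EuclideanSpace ℝ (Fin n)))
    {p q : ℕ} (γ : ℝ → M) (A : ℝ → Components n p q) (t : ℝ) : Components n p q :=
  fun i j => deriv (fun s => A s i j) t
    + connectionTerm g e (coord e (γ t)) (fun l => deriv (fun s => coord e (γ s) l) t) (A t) i j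

/-! ### The rescaled Sasaki type metric on the tensor bundle -/

/-- The vertical lift of a tensor with components `A`. -/
def verticalLift {p q : ℕ} (A : Components n p q) : Idx n p q → ℝ := mkIdx 0 A

/-- The horizontal lift of `ξ = ξ^i ∂_i` to the point `z = (x,t)`. -/
def horizontalLift (g : Metric n M) (e : OpenPartialHomeomorph M (EuclideanSpace ℝ (Fin n)))
    {p q : ℕ} (z : Idx n p q → ℝ) (ξ : Fin n → ℝ) : Idx n p q → ℝ :=
  mkIdx ξ (- connectionTerm g e (basePart z) ξ (fibrePart z))

/-- The tensor `A` such that `v` is the sum of the horizontal lift of its base part and of the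
vertical lift of `A`, for a tangent vector `v` at `z`. -/
def verticalPart (g : Metric n M) (e : OpenPartialHomeomorph M (EuclideanSpace ℝ (Fin n)))
    {p q : ℕ} (z v : Idx n p q → ℝ) : Components n p q :=
  fibrePart v + connectionTerm g e (basePart z) (basePart v) (fibrePart z)

/-- The extension of the scalar product to tensors,
`G(A,B) = g_{i_1 k_1} ⋯ g_{i_p k_p} g^{j_1 l_1} ⋯ g^{j_q l_q} A^{i…}_{j…} B^{k…}_{l…}`. -/
def tensorInner (g : Metric n M) (e : OpenPartialHomeomorph M (EuclideanSpace ℝ (Fin n)))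
    {p q : ℕ} (x : Fin n → ℝ) (A B : Components n p q) : ℝ :=
  ∑ i, ∑ k, ∑ j, ∑ l, (∏ a, metricMatrix g e x (i a) (k a)) *
    (∏ b, (metricMatrix g e x)⁻¹ (j b) (l b)) * A i j * B k l

/-- The rescaled Sasaki type metric of `T^p_q(M)`, evaluated on tangent vectors `v`, `w` at `z`, in
the coordinates induced by `e`: on horizontal lifts it is `f g`, on vertical lifts it is `G`, and
horizontal and vertical lifts are orthogonal. -/
def sasaki (g : Metric n M) (f : M → ℝ) (e : OpenPartialHomeomorph M (EuclideanSpace ℝ (Fin n)))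
    {p q : ℕ} (z v w : Idx n p q → ℝ) : ℝ :=
  f (point e (basePart z)) *
      (∑ i, ∑ j, metricMatrix g e (basePart z) i j * basePart v i * basePart w j)
    + tensorInner g e (basePart z) (verticalPart g e z v) (verticalPart g e z w)

section SasakiFacts

variable (g : Metric n M) (f : M → ℝ) (e : OpenPartialHomeomorph M (EuclideanSpace ℝ (Fin n)))
  {p q : ℕ} (z : Idx n p q → ℝ)

theorem basePart_mkIdx (x : Fin n → ℝ) (A : Components n p q) : basePart (mkIdx x A) = x := rfl

theorem fibrePart_mkIdx (x : Fin n → ℝ) (A : Components n p q) : fibrePart (mkIdx x A) = A := rfl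

theorem verticalPart_verticalLift (A : Components n p q) :
    verticalPart g e z (verticalLift A) = A := by
  funext i j
  simp [verticalPart, verticalLift, fibrePart_mkIdx, basePart_mkIdx, connectionTerm, act]

theorem verticalPart_horizontalLift (ξ : Fin n → ℝ) :
    verticalPart g e z (horizontalLift g e z ξ) = 0 := by
  rw [verticalPart, horizontalLift, fibrePart_mkIdx, basePart_mkIdx, neg_add_cancel]

theorem sasaki_vertical_vertical (A B : Components n p q) :
    sasaki g f e z (verticalLift A) (verticalLift B) = tensorInner g e (basePart z) A B := by
  rw [sasaki, verticalPart_verticalLift, verticalPart_verticalLift]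
  simp [verticalLift, basePart_mkIdx]

theorem sasaki_vertical_horizontal (A : Components n p q) (ξ : Fin n → ℝ) :
    sasaki g f e z (verticalLift A) (horizontalLift g e z ξ) = 0 := by
  rw [sasaki, verticalPart_verticalLift, verticalPart_horizontalLift]
  simp [verticalLift, basePart_mkIdx, tensorInner]

theorem sasaki_horizontal_horizontal (ξ η : Fin n → ℝ) :
    sasaki g f e z (horizontalLift g e z ξ) (horizontalLift g e z η) =
      f (point e (basePart z)) * ∑ i, ∑ j, metricMatrix g e (basePart z) i j * ξ i * η j := by
  rw [sasaki, verticalPart_horizontalLift, verticalPart_horizontalLift]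
  simp [horizontalLift, basePart_mkIdx, tensorInner]

end SasakiFacts

/-- The matrix of components of the rescaled Sasaki type metric in induced coordinates. -/
def sasakiMatrix (g : Metric n M) (f : M → ℝ)
    (e : OpenPartialHomeomorph M (EuclideanSpace ℝ (Fin n))) {p q : ℕ} (z : Idx n p q → ℝ) :
    Matrix (Idx n p q) (Idx n p q) ℝ :=
  fun a b => sasaki g f e z (Pi.single a 1) (Pi.single b 1)

/-- The torsion tensor prescribed for the metric connection. At `(x,t)` its only non-zero
components `T^c_{ab}` have `a = l`, `b = j` in the base and `c` in the fibre, with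
`T_{lj} = ∑_λ R_{ljm}^{i_λ} t^{i_1 … m … i_p}_{j_1 … j_q}
  - ∑_μ R_{lj j_μ}^m t^{i_1 … i_p}_{j_1 … m … j_q}`.
As `T` is vertical-valued and vanishes on vertical vectors, these are its components both in the
natural frame `(∂_j, ∂_{\bar j})` and in the adapted frame `(E_j, E_{\bar j})`, where `E_j` is the
horizontal lift of `∂_j` and `E_{\bar j} = ∂_{\bar j}`. -/
def torsion (g : Metric n M) (e : OpenPartialHomeomorph M (EuclideanSpace ℝ (Fin n)))
    {p q : ℕ} (z : Idx n p q → ℝ) : Idx n p q → Idx n p q → Idx n p q → ℝ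
  | Sum.inr (i, j), Sum.inl l, Sum.inl r =>
      act (fun k m => curvature (baseChristoffel g e) (basePart z) l r m k) (fibrePart z) i j
  | _, _, _ => 0

/-- The coefficients, in the natural frame of the coordinates induced by `e`, of the metric
connection of the rescaled Sasaki type metric with the torsion above. -/
def bundleConnection (g : Metric n M) (f : M → ℝ)
    (e : OpenPartialHomeomorph M (EuclideanSpace ℝ (Fin n))) (p q : ℕ) :
    (Idx n p q → ℝ) → Idx n p q → Idx n p q → Idx n p q → ℝ :=
  metricConnection (sasakiMatrix g f e) (torsion g e)

/-! ### Geodesics -/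

/-- `γ`, restricted to the open interval `J`, is a `C²` curve in `M` and a geodesic of the
Levi-Civita connection of `g`: the geodesic equation holds in every smooth chart. -/
def IsGeodesic (g : Metric n M) (J : Set ℝ) (γ : ℝ → M) : Prop :=
  IsOpen J ∧ J.OrdConnected ∧ ContinuousOn γ J ∧
  ∀ e ∈ IsManifold.maximalAtlas (𝓡 n) ∞ M, ∀ t ∈ J, γ t ∈ e.source →
    ContDiffAt ℝ 2 (fun s => coord e (γ s)) t ∧
    GeodesicEquation (baseChristoffel g e) (fun s => coord e (γ s)) t

/-- `c`, restricted to the open interval `J`, is a `C²` curve in `T^p_q(M)` and a geodesic of the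
metric connection above of the rescaled Sasaki type metric: the geodesic equation holds in the
coordinates induced by every smooth chart of `M`. -/
def IsBundleGeodesic (g : Metric n M) (f : M → ℝ) {p q : ℕ} (J : Set ℝ)
    (c : ℝ → TensorBundle n M p q) : Prop :=
  IsOpen J ∧ J.OrdConnected ∧ ContinuousOn (fun s => proj (c s)) J ∧
  ∀ e ∈ IsManifold.maximalAtlas (𝓡 n) ∞ M, ∀ t ∈ J, proj (c t) ∈ e.source →
    ContDiffAt ℝ 2 (fun s => bundleCoord e (c s)) t ∧
    GeodesicEquation (bundleConnection g f e p q) (fun s => bundleCoord e (c s)) t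

/-- `c` is parametrized by arc length on `J`, for the rescaled Sasaki type metric. -/
def IsUnitSpeed (g : Metric n M) (f : M → ℝ) {p q : ℕ} (J : Set ℝ)
    (c : ℝ → TensorBundle n M p q) : Prop :=
  ∀ e ∈ IsManifold.maximalAtlas (𝓡 n) ∞ M, ∀ t ∈ J, proj (c t) ∈ e.source →
    sasaki g f e (bundleCoord e (c t))
      (fun a => deriv (fun s => bundleCoord e (c s) a) t)
      (fun a => deriv (fun s => bundleCoord e (c s) a) t) = 1

/-- The tensor field along the projection of `c` that `c` defines has vanishing second covariant
derivative on `J`. -/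
def HasVanishingSecondCovDeriv (g : Metric n M) {p q : ℕ} (J : Set ℝ)
    (c : ℝ → TensorBundle n M p q) : Prop :=
  ∀ e ∈ IsManifold.maximalAtlas (𝓡 n) ∞ M, ∀ t ∈ J, proj (c t) ∈ e.source →
    covDeriv g e (fun s => proj (c s))
      (covDeriv g e (fun s => proj (c s)) (fun s => components e (c s))) t = 0

end Manifold

end RescaledSasaki

end

/-!
A metric connection is determined by its torsion, so the connection of `ˢg_f` can be recognised
from its effect on horizontal and vertical parts. Differentiate horizontal parts by the Levi-Civita
connection of the conformal metric `f g` and vertical parts by `∇`: the result is metric, since each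
rule preserves its half of `ˢg_f`, and the commutator of `∇` on the fibre coordinate gives it
exactly the prescribed curvature torsion. Hence a curve `(x(s), t(s))` is a geodesic if and only if
`x` is a geodesic of `f g` and `δ²t/ds² = 0`.

If `f` is constant, `f g` and `g` have the same geodesics. Conversely, the zero section lifts every
geodesic of `f g` of unit speed to a geodesic parametrized by arc length. If its projection `x` is
also a geodesic of `g`, then both `g(x', x')` and `f g(x', x')` are constant, so `df(x') = 0`. Since
`x'` can have any direction at any point, `df = 0`.
-/

noncomputable section

namespace RescaledSasaki

/-! ### Metric connections in coordinates -/

section MetricConnection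

open Matrix

variable {κ : Type*} [Fintype κ]

theorem dotProduct_mulVec_comm {G : Matrix κ κ ℝ} (hG : G.IsSymm) (v w : κ → ℝ) :
    v ⬝ᵥ G *ᵥ w = w ⬝ᵥ G *ᵥ v := by
  rw [dotProduct_mulVec, ← mulVec_transpose, hG.eq, dotProduct_comm]

theorem dotProduct_mulVec_eq_sum (G : Matrix κ κ ℝ) (v w : κ → ℝ) :
    v ⬝ᵥ G *ᵥ w = ∑ a, ∑ b, G a b * v a * w b := by
  simp only [dotProduct, mulVec, Finset.mul_sum]
  exact Finset.sum_congr rfl fun _ _ => Finset.sum_congr rfl fun _ _ => by ring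

/-- The matrix `u^a Γ^c_{ab}` (row `c`, column `b`) of the connection in the direction `u`, for
coefficients `Γ c a b = Γ^c_{ab}` at a point: the covariant derivative of a vector field `w` along
a curve with velocity `u` is `w' + connectionMatrix Γ u *ᵥ w`. -/
def connectionMatrix (Γ : κ → κ → κ → ℝ) : (κ → ℝ) →ₗ[ℝ] Matrix κ κ ℝ where
  toFun u := Matrix.of fun c b => ∑ a, u a * Γ c a b
  map_add' u v := by ext; simp [add_mul, Finset.sum_add_distrib]
  map_smul' r u := by ext; simp [Finset.mul_sum, mul_assoc]

theorem connectionMatrix_apply (Γ : κ → κ → κ → ℝ) (u : κ → ℝ) (c b : κ) :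
    connectionMatrix Γ u c b = ∑ a, u a * Γ c a b := rfl

theorem connectionMatrix_mulVec_apply (Γ : κ → κ → κ → ℝ) (u v : κ → ℝ) (c : κ) :
    (connectionMatrix Γ u *ᵥ v) c = ∑ a, ∑ b, Γ c a b * u a * v b := by
  simp only [mulVec, dotProduct, connectionMatrix_apply, Finset.sum_mul]
  rw [Finset.sum_comm]
  exact Finset.sum_congr rfl fun _ _ => Finset.sum_congr rfl fun _ _ => by ring

variable [DecidableEq κ]

/-- The derivative at `z`, in the direction `u`, of the matrix-valued function `G`. -/
def matrixDeriv (G : (κ → ℝ) → Matrix κ κ ℝ) (z : κ → ℝ) : (κ → ℝ) →ₗ[ℝ] Matrix κ κ ℝ where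
  toFun u := Matrix.of fun a b => fderiv ℝ (fun w => G w a b) z u
  map_add' u v := by ext; simp
  map_smul' r u := by ext; simp

theorem matrixDeriv_apply_apply (G : (κ → ℝ) → Matrix κ κ ℝ) (z u : κ → ℝ) (b d : κ) :
    matrixDeriv G z u b d = ∑ a, u a * pd a (fun w => G w b d) z := by
  change fderiv ℝ (fun w => G w b d) z u = _
  conv_lhs => rw [pi_eq_sum_univ' u]
  simp [pd, map_sum]

variable {G : (κ → ℝ) → Matrix κ κ ℝ} {T : (κ → ℝ) → κ → κ → κ → ℝ}

theorem matrixDeriv_eq_metricConnection (hG : ∀ w, (G w).IsSymm)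
    (hT : ∀ w c a b, T w c a b = -T w c b a) {z : κ → ℝ} (hz : IsUnit (G z).det) (u : κ → ℝ) :
    matrixDeriv G z u = (connectionMatrix (metricConnection G T z) u)ᵀ * G z
      + G z * connectionMatrix (metricConnection G T z) u := by
  ext b d
  have metric : ∀ a, pd a (fun w => G w b d) z = ∑ c, (metricConnection G T z c a b * G z c d
      + metricConnection G T z c a d * G z b c) := fun a => by
    rw [Finset.sum_add_distrib]
    linarith [metricConnection_metric G hG T hT z hz a b d]
  simp only [matrixDeriv_apply_apply, metric, Matrix.add_apply, mul_apply, transpose_apply,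
    connectionMatrix_apply, Finset.sum_mul, Finset.mul_sum, ← Finset.sum_add_distrib]
  rw [Finset.sum_comm]
  exact Finset.sum_congr rfl fun _ _ => Finset.sum_congr rfl fun _ _ => by ring

theorem dotProduct_matrixDeriv_mulVec (hG : ∀ w, (G w).IsSymm)
    (hT : ∀ w c a b, T w c a b = -T w c b a) {z : κ → ℝ} (hz : IsUnit (G z).det) (u v w : κ → ℝ) :
    v ⬝ᵥ matrixDeriv G z u *ᵥ w
      = (connectionMatrix (metricConnection G T z) u *ᵥ v) ⬝ᵥ G z *ᵥ w
        + v ⬝ᵥ G z *ᵥ (connectionMatrix (metricConnection G T z) u *ᵥ w) := by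
  rw [matrixDeriv_eq_metricConnection hG hT hz, add_mulVec, dotProduct_add, ← mulVec_mulVec,
    ← mulVec_mulVec, dotProduct_mulVec v (_ᵀ), vecMul_transpose]

theorem connectionMatrix_metricConnection_sub (hG : ∀ w, (G w).IsSymm)
    (hT : ∀ w c a b, T w c a b = -T w c b a) {z : κ → ℝ} (hz : IsUnit (G z).det) (u v : κ → ℝ) :
    connectionMatrix (metricConnection G T z) u *ᵥ v
        - connectionMatrix (metricConnection G T z) v *ᵥ u
      = connectionMatrix (T z) u *ᵥ v := by
  ext c
  simp only [Pi.sub_apply, connectionMatrix_mulVec_apply]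
  rw [Finset.sum_comm (f := fun a b => _ * v a * u b), ← Finset.sum_sub_distrib]
  refine Finset.sum_congr rfl fun a _ => ?_
  rw [← Finset.sum_sub_distrib]
  refine Finset.sum_congr rfl fun b _ => ?_
  rw [← metricConnection_torsion G hG T hT z hz c a b]
  ring

-- The difference of two metric connections with the same torsion, lowered by `G`, is symmetric in
-- its first two arguments and antisymmetric in its last two, hence zero.
theorem connectionMatrix_metricConnection_unique (hG : ∀ w, (G w).IsSymm)
    (hT : ∀ w c a b, T w c a b = -T w c b a) {z : κ → ℝ} (hz : IsUnit (G z).det)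
    {B : (κ → ℝ) → (κ → ℝ) → κ → ℝ}
    (metric : ∀ u v w, v ⬝ᵥ matrixDeriv G z u *ᵥ w = B u v ⬝ᵥ G z *ᵥ w + v ⬝ᵥ G z *ᵥ B u w)
    (torsion : ∀ u v, B u v - B v u = connectionMatrix (T z) u *ᵥ v) (u v : κ → ℝ) :
    connectionMatrix (metricConnection G T z) u *ᵥ v = B u v := by
  let D : (κ → ℝ) → (κ → ℝ) → κ → ℝ :=
    fun u v => connectionMatrix (metricConnection G T z) u *ᵥ v - B u v
  have D_symm : ∀ u v, D u v = D v u := fun u v => by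
    have := (connectionMatrix_metricConnection_sub hG hT hz u v).trans (torsion u v).symm
    rw [← sub_eq_zero] at this ⊢
    rw [← this]
    simp only [D]
    abel
  have D_antisymm : ∀ u v w, D u v ⬝ᵥ G z *ᵥ w = -(D u w ⬝ᵥ G z *ᵥ v) := fun u v w => by
    have h := (dotProduct_matrixDeriv_mulVec hG hT hz u v w).symm.trans (metric u v w)
    rw [dotProduct_mulVec_comm (hG z) v, dotProduct_mulVec_comm (hG z) v] at h
    simp only [D, sub_dotProduct]
    linarith
  refine sub_eq_zero.1 <| (nondegenerate_of_det_ne_zero hz.ne_zero).eq_zero_of_ortho fun w => ?_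
  change D u v ⬝ᵥ G z *ᵥ w = 0
  have h := D_antisymm u v w
  rw [D_symm u w, D_antisymm w u v, D_symm w v, D_antisymm v w u, D_symm v u] at h
  linarith

theorem metricConnection_zero (G : (κ → ℝ) → Matrix κ κ ℝ) :
    metricConnection G 0 = christoffel G := by
  funext z c a b
  simp [metricConnection, contorsion]

theorem dotProduct_matrixDeriv_mulVec_christoffel (hG : ∀ w, (G w).IsSymm) {z : κ → ℝ}
    (hz : IsUnit (G z).det) (u v w : κ → ℝ) :
    v ⬝ᵥ matrixDeriv G z u *ᵥ w = (connectionMatrix (christoffel G z) u *ᵥ v) ⬝ᵥ G z *ᵥ w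
      + v ⬝ᵥ G z *ᵥ (connectionMatrix (christoffel G z) u *ᵥ w) := by
  simpa only [metricConnection_zero]
    using dotProduct_matrixDeriv_mulVec (T := 0) hG (by simp) hz u v w

theorem connectionMatrix_christoffel_unique (hG : ∀ w, (G w).IsSymm) {z : κ → ℝ}
    (hz : IsUnit (G z).det) {B : (κ → ℝ) → (κ → ℝ) → κ → ℝ}
    (metric : ∀ u v w, v ⬝ᵥ matrixDeriv G z u *ᵥ w = B u v ⬝ᵥ G z *ᵥ w + v ⬝ᵥ G z *ᵥ B u w)
    (symm : ∀ u v, B u v = B v u) (u v : κ → ℝ) :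
    connectionMatrix (christoffel G z) u *ᵥ v = B u v := by
  rw [← metricConnection_zero]
  refine connectionMatrix_metricConnection_unique hG (by simp) hz metric (fun u v => ?_) u v
  rw [symm u v, sub_self]
  ext c
  simp [connectionMatrix_mulVec_apply]

theorem christoffel_comm (hG : ∀ w, (G w).IsSymm) (z : κ → ℝ) (c a b : κ) :
    christoffel G z c a b = christoffel G z c b a := by
  have h : ∀ w, G w a b = G w b a := fun w => (hG w).apply b a
  simp only [christoffel, h, add_comm (pd a _ z)]

theorem connectionMatrix_christoffel_mulVec_comm (hG : ∀ w, (G w).IsSymm) (z u v : κ → ℝ) :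
    connectionMatrix (christoffel G z) u *ᵥ v = connectionMatrix (christoffel G z) v *ᵥ u := by
  ext c
  rw [connectionMatrix_mulVec_apply, connectionMatrix_mulVec_apply, Finset.sum_comm]
  refine Finset.sum_congr rfl fun _ _ => Finset.sum_congr rfl fun _ _ => ?_
  rw [christoffel_comm hG]
  ring

theorem christoffel_const_smul {C : ℝ} (hC : C ≠ 0) (G : (κ → ℝ) → Matrix κ κ ℝ) {z : κ → ℝ}
    (hz : IsUnit (G z).det) : christoffel (fun w => C • G w) z = christoffel G z := by
  have h_pd : ∀ a r s, pd a (fun w => C * G w r s) z = C * pd a (fun w => G w r s) z :=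
    fun a r s =>
      DFunLike.congr_fun (congrFun (fderiv_const_smul_field (𝕜 := ℝ) C) z) (Pi.single a 1)
  have h_inv : (C • G z)⁻¹ = C⁻¹ • (G z)⁻¹ := by
    refine inv_eq_left_inv ?_
    rw [smul_mul_smul_comm, inv_mul_cancel₀ hC, nonsing_inv_mul _ hz, one_smul]
  funext c a b
  simp only [christoffel, h_inv, Matrix.smul_apply, smul_eq_mul, h_pd]
  congr 1
  refine Finset.sum_congr rfl fun d _ => ?_
  field_simp

end MetricConnection

section MatrixCalculus

open Matrix

variable {l m n : Type*}

theorem hasDerivAt_matrix_iff [Finite m] [Finite n] {A : ℝ → Matrix m n ℝ} {A' : Matrix m n ℝ}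
    {t : ℝ} : HasDerivAt A A' t ↔ ∀ i j, HasDerivAt (fun s => A s i j) (A' i j) t := by
  have := Fintype.ofFinite m
  have := Fintype.ofFinite n
  exact (hasDerivAt_pi (φ := A) (φ' := A')).trans (forall_congr' fun _ => hasDerivAt_pi)

theorem hasDerivAt_matrix_transpose [Finite m] [Finite n] {A : ℝ → Matrix m n ℝ}
    {A' : Matrix m n ℝ} {t : ℝ} (hA : HasDerivAt A A' t) : HasDerivAt (fun s => (A s)ᵀ) A'ᵀ t :=
  hasDerivAt_matrix_iff.2 fun i j => hasDerivAt_matrix_iff.1 hA j i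

theorem hasDerivAt_matrix_mul [Finite l] [Fintype m] [Finite n] {A : ℝ → Matrix l m ℝ}
    {B : ℝ → Matrix m n ℝ} {A' : Matrix l m ℝ} {B' : Matrix m n ℝ} {t : ℝ}
    (hA : HasDerivAt A A' t) (hB : HasDerivAt B B' t) :
    HasDerivAt (fun s => A s * B s) (A' * B t + A t * B') t := by
  refine hasDerivAt_matrix_iff.2 fun i j => ?_
  simp only [mul_apply, Matrix.add_apply, ← Finset.sum_add_distrib]
  exact HasDerivAt.fun_sum fun k _ =>
    (hasDerivAt_matrix_iff.1 hA i k).mul (hasDerivAt_matrix_iff.1 hB k j)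

variable [Fintype m] [DecidableEq m]

open scoped Matrix.Norms.Operator in
theorem hasDerivAt_matrix_inv {S : ℝ → Matrix m m ℝ} {S' : Matrix m m ℝ} {t : ℝ}
    (hS : HasDerivAt S S' t) (hdet : IsUnit (S t).det) :
    HasDerivAt (fun s => (S s)⁻¹) (-((S t)⁻¹ * S' * (S t)⁻¹)) t := by
  obtain ⟨u, hu⟩ := (isUnit_iff_isUnit_det _).2 hdet
  have h_inverse := hu ▸ hasFDerivAt_ringInverse (𝕜 := ℝ) u
  simp only [nonsing_inv_eq_ringInverse]
  refine (h_inverse.comp_hasDerivAt t hS).congr_deriv ?_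
  simp [← hu]

open scoped Matrix.Norms.Operator in
theorem contDiffAt_matrix_inv_apply {E : Type*} [NormedAddCommGroup E] [NormedSpace ℝ E]
    {k : WithTop ℕ∞} {S : E → Matrix m m ℝ} {x : E}
    (hS : ∀ i j, ContDiffAt ℝ k (fun z => S z i j) x) (hdet : IsUnit (S x).det) (i j : m) :
    ContDiffAt ℝ k (fun z => (S z)⁻¹ i j) x := by
  obtain ⟨u, hu⟩ := (isUnit_iff_isUnit_det _).2 hdet
  have hS : ContDiffAt ℝ k S x := by
    have h : S = fun z => ∑ i, ∑ j, S z i j • Matrix.single i j (1 : ℝ) := by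
      funext z
      conv_lhs => rw [matrix_eq_sum_single (S z)]
      simp [smul_single]
    rw [h]
    exact ContDiffAt.sum fun i _ => ContDiffAt.sum fun j _ => (hS i j).smul contDiffAt_const
  have h_inv : ContDiffAt ℝ k (fun z => (S z)⁻¹) x := by
    simp only [nonsing_inv_eq_ringInverse]
    exact ContDiffAt.comp x (hu ▸ contDiffAt_ringInverse ℝ u) hS
  exact (entryLinearMap ℝ ℝ i j).toContinuousLinearMap.contDiff.contDiffAt.comp x h_inv

end MatrixCalculus

section Curves

open Matrix Topology

variable {κ : Type*}

theorem hasDerivAt_deriv_of_contDiffAt {E : Type*} [NormedAddCommGroup E] [NormedSpace ℝ E]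
    {X : ℝ → E} {t : ℝ} (hX : ContDiffAt ℝ 2 X t) :
    HasDerivAt (deriv X) (deriv (deriv X) t) t := by
  have h : ContDiffAt ℝ 1 (fderiv ℝ X) t := hX.fderiv_right (by norm_num)
  exact ((h.clm_apply contDiffAt_const).differentiableAt one_ne_zero).hasDerivAt

theorem eventually_differentiableAt {E F : Type*} [NormedAddCommGroup E] [NormedSpace ℝ E]
    [NormedAddCommGroup F] [NormedSpace ℝ F] {X : E → F} {t : E} (hX : ContDiffAt ℝ 2 X t) :
    ∀ᶠ s in 𝓝 t, DifferentiableAt ℝ X s :=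
  (hX.eventually (by simp)).mono fun _ h => h.differentiableAt two_ne_zero

theorem deriv_apply [Finite κ] {X : ℝ → κ → ℝ} {t : ℝ} (hX : DifferentiableAt ℝ X t) (c : κ) :
    deriv (fun s => X s c) t = deriv X t c := by
  have := Fintype.ofFinite κ
  exact (hasDerivAt_pi.1 hX.hasDerivAt c).deriv

theorem hasDerivAt_fderiv_comp {E F : Type*} [NormedAddCommGroup E] [NormedSpace ℝ E]
    [NormedAddCommGroup F] [NormedSpace ℝ F] {Φ : E → F} {X V : ℝ → E} {u V' : E} {t : ℝ}
    (hΦ : ContDiffAt ℝ 2 Φ (X t)) (hX : HasDerivAt X u t) (hV : HasDerivAt V V' t) :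
    HasDerivAt (fun s => fderiv ℝ Φ (X s) (V s))
      (fderiv ℝ (fderiv ℝ Φ) (X t) u (V t) + fderiv ℝ Φ (X t) V') t := by
  have h : DifferentiableAt ℝ (fderiv ℝ Φ) (X t) :=
    (hΦ.fderiv_right (m := 1) (by norm_num)).differentiableAt one_ne_zero
  exact (h.hasFDerivAt.comp_hasDerivAt t hX).clm_apply hV

theorem exists_curve_hasDerivAt {E : Type*} [NormedAddCommGroup E] [NormedSpace ℝ E] (z u : E) :
    ∃ X : ℝ → E, X 0 = z ∧ HasDerivAt X u 0 :=
  ⟨fun s => z + s • u, by simp, by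
    simpa using ((hasDerivAt_id (0 : ℝ)).smul_const u).const_add z⟩

theorem hasDerivAt_matrix_comp [Finite κ] {G : (κ → ℝ) → Matrix κ κ ℝ} {X : ℝ → κ → ℝ}
    {u : κ → ℝ} {t : ℝ} (hG : ∀ a b, DifferentiableAt ℝ (fun w => G w a b) (X t))
    (hX : HasDerivAt X u t) : HasDerivAt (fun s => G (X s)) (matrixDeriv G (X t) u) t := by
  have := Fintype.ofFinite κ
  exact hasDerivAt_matrix_iff.2 fun a b => (hG a b).hasFDerivAt.comp_hasDerivAt t hX

variable [Fintype κ]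

theorem hasDerivAt_dotProduct_mulVec {A : ℝ → Matrix κ κ ℝ} {A' : Matrix κ κ ℝ} {V W : ℝ → κ → ℝ}
    {V' W' : κ → ℝ} {t : ℝ} (hA : HasDerivAt A A' t)
    (hV : HasDerivAt V V' t) (hW : HasDerivAt W W' t) :
    HasDerivAt (fun s => V s ⬝ᵥ A s *ᵥ W s)
      (V' ⬝ᵥ A t *ᵥ W t + V t ⬝ᵥ A' *ᵥ W t + V t ⬝ᵥ A t *ᵥ W') t := by
  simp only [dotProduct_mulVec_eq_sum, ← Finset.sum_add_distrib]
  refine HasDerivAt.fun_sum fun a _ => HasDerivAt.fun_sum fun b _ => ?_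
  refine (((hasDerivAt_matrix_iff.1 hA a b).mul (hasDerivAt_pi.1 hV a)).mul
    (hasDerivAt_pi.1 hW b)).congr_deriv ?_
  simp only [Pi.mul_apply]
  ring

theorem dotProduct_matrixDeriv_mulVec_eq_of_hasDerivAt {G : (κ → ℝ) → Matrix κ κ ℝ}
    {X : ℝ → κ → ℝ} {u v w : κ → ℝ} {t d : ℝ}
    (hG : ∀ a b, DifferentiableAt ℝ (fun w => G w a b) (X t)) (hX : HasDerivAt X u t)
    (h : HasDerivAt (fun s => v ⬝ᵥ G (X s) *ᵥ w) d t) :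
    v ⬝ᵥ matrixDeriv G (X t) u *ᵥ w = d := by
  have h' := hasDerivAt_dotProduct_mulVec (hasDerivAt_matrix_comp hG hX) (hasDerivAt_const t v)
    (hasDerivAt_const t w)
  simpa using h'.unique h

/-- The covariant acceleration `∇_{X'} X'` of the curve `X` for the connection with coefficients
`Γ`. -/
def acceleration (Γ : (κ → ℝ) → κ → κ → κ → ℝ) (X : ℝ → κ → ℝ) (t : ℝ) : κ → ℝ :=
  deriv (deriv X) t + connectionMatrix (Γ (X t)) (deriv X t) *ᵥ deriv X t

theorem geodesicEquation_iff (Γ : (κ → ℝ) → κ → κ → κ → ℝ) {X : ℝ → κ → ℝ} {t : ℝ}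
    (hX : ContDiffAt ℝ 2 X t) : GeodesicEquation Γ X t ↔ acceleration Γ X t = 0 := by
  have h_deriv2 : ∀ c, deriv (fun r => deriv (fun s => X s c) r) t = deriv (deriv X) t c :=
    fun c => by
      rw [← deriv_apply (hasDerivAt_deriv_of_contDiffAt hX).differentiableAt c]
      exact Filter.EventuallyEq.deriv_eq
        ((eventually_differentiableAt hX).mono fun s hs => deriv_apply hs c)
  simp only [GeodesicEquation, h_deriv2, deriv_apply (hX.differentiableAt two_ne_zero),
    ← connectionMatrix_mulVec_apply, funext_iff, acceleration, Pi.add_apply, Pi.zero_apply]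

variable [DecidableEq κ] {G : (κ → ℝ) → Matrix κ κ ℝ}

theorem hasDerivAt_dotProduct_metric_mulVec (hsymm : ∀ w, (G w).IsSymm) {X V W : ℝ → κ → ℝ}
    {u V' W' : κ → ℝ} {t : ℝ} (hdet : IsUnit (G (X t)).det)
    (hG : ∀ a b, DifferentiableAt ℝ (fun w => G w a b) (X t))
    (hX : HasDerivAt X u t) (hV : HasDerivAt V V' t) (hW : HasDerivAt W W' t) :
    HasDerivAt (fun s => V s ⬝ᵥ G (X s) *ᵥ W s)
      ((V' + connectionMatrix (christoffel G (X t)) u *ᵥ V t) ⬝ᵥ G (X t) *ᵥ W t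
        + V t ⬝ᵥ G (X t) *ᵥ (W' + connectionMatrix (christoffel G (X t)) u *ᵥ W t)) t := by
  refine (hasDerivAt_dotProduct_mulVec (hasDerivAt_matrix_comp hG hX) hV hW).congr_deriv ?_
  rw [dotProduct_matrixDeriv_mulVec_christoffel hsymm hdet, add_dotProduct, mulVec_add,
    dotProduct_add]
  ring

theorem hasDerivAt_energy (hsymm : ∀ w, (G w).IsSymm) {X : ℝ → κ → ℝ} {t : ℝ}
    (hdet : IsUnit (G (X t)).det) (hG : ∀ a b, DifferentiableAt ℝ (fun w => G w a b) (X t))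
    (hX : ContDiffAt ℝ 2 X t) :
    HasDerivAt (fun s => deriv X s ⬝ᵥ G (X s) *ᵥ deriv X s)
      (2 * (acceleration (christoffel G) X t ⬝ᵥ G (X t) *ᵥ deriv X t)) t := by
  refine (hasDerivAt_dotProduct_metric_mulVec hsymm hdet hG
    (hX.differentiableAt two_ne_zero).hasDerivAt (hasDerivAt_deriv_of_contDiffAt hX)
    (hasDerivAt_deriv_of_contDiffAt hX)).congr_deriv ?_
  rw [dotProduct_mulVec_comm (hsymm _) (deriv X t), acceleration]
  ring

section Pullback

variable {G' : (κ → ℝ) → Matrix κ κ ℝ} {Φ : (κ → ℝ) → κ → ℝ} {z : κ → ℝ}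

theorem dotProduct_matrixDeriv_mulVec_of_pullback (hsymm' : ∀ w, (G' w).IsSymm)
    (hdet' : IsUnit (G' (Φ z)).det) (hG : ∀ a b, DifferentiableAt ℝ (fun w => G w a b) z)
    (hG' : ∀ a b, DifferentiableAt ℝ (fun w => G' w a b) (Φ z)) (hΦ : ContDiffAt ℝ 2 Φ z)
    (hpull : ∀ᶠ y in 𝓝 z, ∀ v w,
      v ⬝ᵥ G y *ᵥ w = fderiv ℝ Φ y v ⬝ᵥ G' (Φ y) *ᵥ fderiv ℝ Φ y w) (u v w : κ → ℝ) :
    v ⬝ᵥ matrixDeriv G z u *ᵥ w =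
      (fderiv ℝ (fderiv ℝ Φ) z u v
          + connectionMatrix (christoffel G' (Φ z)) (fderiv ℝ Φ z u) *ᵥ fderiv ℝ Φ z v)
        ⬝ᵥ G' (Φ z) *ᵥ fderiv ℝ Φ z w
      + fderiv ℝ Φ z v ⬝ᵥ G' (Φ z) *ᵥ (fderiv ℝ (fderiv ℝ Φ) z u w
          + connectionMatrix (christoffel G' (Φ z)) (fderiv ℝ Φ z u) *ᵥ fderiv ℝ Φ z w) := by
  obtain ⟨X, rfl, hX⟩ := exists_curve_hasDerivAt z u
  have hΦX : HasDerivAt (fun s => Φ (X s)) (fderiv ℝ Φ (X 0) u) 0 :=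
    (hΦ.differentiableAt two_ne_zero).hasFDerivAt.comp_hasDerivAt 0 hX
  have hdΦ : ∀ v, HasDerivAt (fun s => fderiv ℝ Φ (X s) v)
      (fderiv ℝ (fderiv ℝ Φ) (X 0) u v) 0 := fun v => by
    simpa using hasDerivAt_fderiv_comp hΦ hX (hasDerivAt_const 0 v)
  refine dotProduct_matrixDeriv_mulVec_eq_of_hasDerivAt hG hX ?_
  have h := hasDerivAt_dotProduct_metric_mulVec hsymm' hdet' hG' hΦX (hdΦ v) (hdΦ w)
  exact h.congr_of_eventuallyEq
    ((hX.continuousAt.eventually hpull).mono fun s hs => hs v w)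

-- Pulling back the Levi-Civita connection of `G'` by `Φ` gives a torsion-free metric connection of
-- `G`, which is the Levi-Civita connection of `G` by uniqueness.
theorem fderiv_connectionMatrix_christoffel_mulVec (hsymm : ∀ w, (G w).IsSymm)
    (hsymm' : ∀ w, (G' w).IsSymm) (hdet : IsUnit (G z).det) (hdet' : IsUnit (G' (Φ z)).det)
    (hG : ∀ a b, DifferentiableAt ℝ (fun w => G w a b) z)
    (hG' : ∀ a b, DifferentiableAt ℝ (fun w => G' w a b) (Φ z)) (hΦ : ContDiffAt ℝ 2 Φ z)
    (hpull : ∀ᶠ y in 𝓝 z, ∀ v w,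
      v ⬝ᵥ G y *ᵥ w = fderiv ℝ Φ y v ⬝ᵥ G' (Φ y) *ᵥ fderiv ℝ Φ y w) (u v : κ → ℝ) :
    fderiv ℝ Φ z (connectionMatrix (christoffel G z) u *ᵥ v) = fderiv ℝ (fderiv ℝ Φ) z u v
      + connectionMatrix (christoffel G' (Φ z)) (fderiv ℝ Φ z u) *ᵥ fderiv ℝ Φ z v := by
  have pullback_z := hpull.self_of_nhds
  have injective : Function.Injective (fderiv ℝ Φ z) := by
    refine (injective_iff_map_eq_zero _).2 fun v hv => ?_
    refine (nondegenerate_of_det_ne_zero hdet.ne_zero).eq_zero_of_ortho fun w => ?_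
    rw [pullback_z, hv, zero_dotProduct]
  have surjective : Function.Surjective (fderiv ℝ Φ z) :=
    LinearMap.surjective_of_injective (f := (fderiv ℝ Φ z).toLinearMap) injective
  choose B hB using fun u v => surjective (fderiv ℝ (fderiv ℝ Φ) z u v
    + connectionMatrix (christoffel G' (Φ z)) (fderiv ℝ Φ z u) *ᵥ fderiv ℝ Φ z v)
  have second_symm : IsSymmSndFDerivAt ℝ Φ z := hΦ.isSymmSndFDerivAt (by simp)
  rw [connectionMatrix_christoffel_unique hsymm hdet (B := B) (fun u v w => ?_)
    (fun u v => injective ?_), hB]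
  · rw [dotProduct_matrixDeriv_mulVec_of_pullback hsymm' hdet' hG hG' hΦ hpull, ← hB, ← hB,
      pullback_z, pullback_z]
  · rw [hB, hB, second_symm.eq, connectionMatrix_christoffel_mulVec_comm hsymm']

theorem acceleration_christoffel_comp {X : ℝ → κ → ℝ} {t : ℝ} (hsymm : ∀ w, (G w).IsSymm)
    (hsymm' : ∀ w, (G' w).IsSymm) (hdet : IsUnit (G (X t)).det)
    (hdet' : IsUnit (G' (Φ (X t))).det)
    (hG : ∀ a b, DifferentiableAt ℝ (fun w => G w a b) (X t))
    (hG' : ∀ a b, DifferentiableAt ℝ (fun w => G' w a b) (Φ (X t)))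
    (hΦ : ContDiffAt ℝ 2 Φ (X t)) (hX : ContDiffAt ℝ 2 X t)
    (hpull : ∀ᶠ y in 𝓝 (X t), ∀ v w,
      v ⬝ᵥ G y *ᵥ w = fderiv ℝ Φ y v ⬝ᵥ G' (Φ y) *ᵥ fderiv ℝ Φ y w) :
    acceleration (christoffel G') (fun s => Φ (X s)) t
      = fderiv ℝ Φ (X t) (acceleration (christoffel G) X t) := by
  have h_deriv : deriv (fun s => Φ (X s)) =ᶠ[𝓝 t] fun s => fderiv ℝ Φ (X s) (deriv X s) := by
    filter_upwards [hX.continuousAt.eventually (eventually_differentiableAt hΦ),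
      eventually_differentiableAt hX] with s hs hXs
    exact (hs.hasFDerivAt.comp_hasDerivAt s hXs.hasDerivAt).deriv
  have h_deriv2 := (hasDerivAt_fderiv_comp hΦ (hX.differentiableAt two_ne_zero).hasDerivAt
    (hasDerivAt_deriv_of_contDiffAt hX)).deriv
  rw [acceleration, acceleration, h_deriv.deriv_eq, h_deriv.eq_of_nhds, h_deriv2, map_add,
    fderiv_connectionMatrix_christoffel_mulVec hsymm hsymm' hdet hdet' hG hG' hΦ hpull]
  abel

end Pullback

end Curves

section Smoothness

variable {κ : Type*} [Fintype κ] [DecidableEq κ]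

theorem contDiffAt_pd {F : (κ → ℝ) → ℝ} {x : κ → ℝ} (hF : ContDiffAt ℝ ∞ F x) (a : κ) :
    ContDiffAt ℝ ∞ (pd a F) x :=
  (hF.fderiv_right (m := ∞) (by simp)).clm_apply contDiffAt_const

theorem contDiffAt_christoffel {G : (κ → ℝ) → Matrix κ κ ℝ} {x : κ → ℝ}
    (hG : ∀ a b, ContDiffAt ℝ ∞ (fun z => G z a b) x) (hx : IsUnit (G x).det) (c a b : κ) :
    ContDiffAt ℝ ∞ (fun z => christoffel G z c a b) x :=
  contDiffAt_const.mul (ContDiffAt.sum fun d _ => (contDiffAt_matrix_inv_apply hG hx c d).mul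
    (((contDiffAt_pd (hG b d) a).add (contDiffAt_pd (hG a d) b)).sub (contDiffAt_pd (hG a b) d)))

end Smoothness

section LocalExistence

open Set

theorem exists_hasDerivAt_Ioo_of_contDiffAt {E : Type*} [NormedAddCommGroup E] [NormedSpace ℝ E]
    [CompleteSpace E] {F : E → E} {W : Set E} (hW : IsOpen W) {y₀ : E} (hy₀ : y₀ ∈ W)
    (hF : ContDiffAt ℝ 1 F y₀) :
    ∃ ε > 0, ∃ y : ℝ → E, y 0 = y₀ ∧ ∀ t ∈ Ioo (-ε) ε, y t ∈ W ∧ HasDerivAt y (F (y t)) t := by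
  obtain ⟨y, hy0, ε, hε, hy⟩ :=
    hF.exists_forall_mem_closedBall_exists_eq_forall_mem_Ioo_hasDerivAt₀ 0
  simp only [zero_sub, zero_add] at hy
  have hcont : ContinuousAt y 0 := (hy 0 ⟨neg_lt_zero.2 hε, hε⟩).continuousAt
  obtain ⟨δ, hδ, hball⟩ :=
    Metric.mem_nhds_iff.1 (hcont.preimage_mem_nhds (hW.mem_nhds (hy0 ▸ hy₀)))
  refine ⟨min ε δ, lt_min hε hδ, y, hy0, fun t ht => ⟨hball ?_, hy t ?_⟩⟩
  · rw [Real.ball_zero_eq_Ioo]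
    exact Ioo_subset_Ioo (neg_le_neg (min_le_right ε δ)) (min_le_right ε δ) ht
  · exact Ioo_subset_Ioo (neg_le_neg (min_le_left ε δ)) (min_le_left ε δ) ht

theorem contDiffOn_two_of_hasDerivAt {E : Type*} [NormedAddCommGroup E] [NormedSpace ℝ E]
    {J : Set ℝ} (hJ : IsOpen J) {x v a : ℝ → E} (hx : ∀ t ∈ J, HasDerivAt x (v t) t)
    (hv : ∀ t ∈ J, HasDerivAt v (a t) t) (ha : ContinuousOn a J) : ContDiffOn ℝ 2 x J := by
  have hv1 : ContDiffOn ℝ (0 + 1) v J := by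
    rw [contDiffOn_succ_iff_deriv_of_isOpen hJ, contDiffOn_zero]
    exact ⟨fun t ht => (hv t ht).differentiableAt.differentiableWithinAt, by simp,
      ha.congr fun t ht => (hv t ht).deriv⟩
  rw [zero_add] at hv1
  rw [show (2 : WithTop ℕ∞) = 1 + 1 by norm_num, contDiffOn_succ_iff_deriv_of_isOpen hJ]
  exact ⟨fun t ht => (hx t ht).differentiableAt.differentiableWithinAt, by simp,
    hv1.congr fun t ht => (hx t ht).deriv⟩

theorem exists_acceleration_eq_zero {κ : Type*} [Fintype κ] {Γ : (κ → ℝ) → κ → κ → κ → ℝ}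
    {U : Set (κ → ℝ)} (hU : IsOpen U)
    (hΓ : ∀ z ∈ U, ∀ c a b, ContDiffAt ℝ 1 (fun z => Γ z c a b) z) {x₀ : κ → ℝ} (hx₀ : x₀ ∈ U)
    (ξ : κ → ℝ) :
    ∃ ε > 0, ∃ x : ℝ → κ → ℝ, x 0 = x₀ ∧ deriv x 0 = ξ ∧ ∀ t ∈ Ioo (-ε) ε,
      x t ∈ U ∧ ContDiffAt ℝ 2 x t ∧ acceleration Γ x t = 0 := by
  let F : (κ → ℝ) × (κ → ℝ) → (κ → ℝ) × (κ → ℝ) := fun y =>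
    (y.2, -(connectionMatrix (Γ y.1) y.2).mulVec y.2)
  have hF : ∀ y : (κ → ℝ) × (κ → ℝ), y.1 ∈ U → ContDiffAt ℝ 1 F y := fun y hy => by
    have hsnd : ∀ a, ContDiffAt ℝ 1 (fun y : (κ → ℝ) × (κ → ℝ) => y.2 a) y := fun a =>
      (contDiff_apply ℝ ℝ a).contDiffAt.comp y contDiffAt_snd
    refine contDiffAt_snd.prodMk (ContDiffAt.neg (contDiffAt_pi.2 fun c => ?_))
    simp only [connectionMatrix_mulVec_apply]
    exact ContDiffAt.sum fun a _ => ContDiffAt.sum fun b _ =>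
      ((ContDiffAt.comp (g := fun z => Γ z c a b) y (hΓ y.1 hy c a b) contDiffAt_fst).mul
        (hsnd a)).mul (hsnd b)
  obtain ⟨ε, hε, y, hy0, hy⟩ := exists_hasDerivAt_Ioo_of_contDiffAt (W := Prod.fst ⁻¹' U)
    (hU.preimage continuous_fst) (y₀ := (x₀, ξ)) hx₀ (hF _ hx₀)
  have hx : ∀ t ∈ Ioo (-ε) ε, HasDerivAt (fun s => (y s).1) (y t).2 t := fun t ht =>
    (hasFDerivAt_fst (𝕜 := ℝ) (p := y t)).comp_hasDerivAt t (hy t ht).2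
  have hv : ∀ t ∈ Ioo (-ε) ε, HasDerivAt (fun s => (y s).2) (F (y t)).2 t := fun t ht =>
    (hasFDerivAt_snd (𝕜 := ℝ) (p := y t)).comp_hasDerivAt t (hy t ht).2
  have ha : ContinuousOn (fun t => (F (y t)).2) (Ioo (-ε) ε) := fun t ht =>
    ContinuousAt.continuousWithinAt <| continuousAt_snd.comp <|
      (hF _ (hy t ht).1).continuousAt.comp (hy t ht).2.continuousAt
  refine ⟨ε, hε, fun s => (y s).1, by simp [hy0],
    by rw [(hx 0 ⟨neg_lt_zero.2 hε, hε⟩).deriv, hy0], fun t ht => ⟨(hy t ht).1,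
    (contDiffOn_two_of_hasDerivAt isOpen_Ioo hx hv ha).contDiffAt (isOpen_Ioo.mem_nhds ht), ?_⟩⟩
  have h_deriv : deriv (fun s => (y s).1) =ᶠ[nhds t] fun s => (y s).2 :=
    (isOpen_Ioo.eventually_mem ht).mono fun s hs => (hx s hs).deriv
  rw [acceleration, h_deriv.deriv_eq, h_deriv.eq_of_nhds, (hv t ht).deriv]
  exact neg_add_cancel _

end LocalExistence

/-! ### Tensor powers of matrices -/

section TensorPowers

open Matrix

variable {ι κ R : Type*} [Fintype ι] [DecidableEq ι] [Fintype κ] [DecidableEq κ] [CommRing R]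

/-- The Kronecker product `⨂_a S a` of a family of matrices, acting on families of components
indexed by `ι → κ`. -/
def piKronecker : (ι → Matrix κ κ R) →* Matrix (ι → κ) (ι → κ) R where
  toFun S := Matrix.of fun i k => ∏ a, S a (i a) (k a)
  map_one' := by
    ext i k
    simp [Matrix.one_apply, Fintype.prod_ite_zero, funext_iff]
  map_mul' S S' := by
    ext i k
    simp [mul_apply, Finset.prod_univ_sum, Finset.prod_mul_distrib]

theorem piKronecker_apply (S : ι → Matrix κ κ R) (i k : ι → κ) :
    piKronecker S i k = ∏ a, S a (i a) (k a) := rfl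

theorem transpose_piKronecker (S : ι → Matrix κ κ R) :
    (piKronecker S)ᵀ = piKronecker fun a => (S a)ᵀ := rfl

theorem piKronecker_update_apply (S : ι → Matrix κ κ R) (a : ι) (φ : Matrix κ κ R) (i k : ι → κ) :
    piKronecker (Function.update S a φ) i k
      = φ (i a) (k a) * ∏ b ∈ Finset.univ.erase a, S b (i b) (k b) := by
  rw [piKronecker_apply, ← Finset.mul_prod_erase _ _ (Finset.mem_univ a), Function.update_self]
  congr 1
  exact Finset.prod_congr rfl fun b hb => by rw [Function.update_of_ne (Finset.ne_of_mem_erase hb)]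

/-- The derivation `∑_a 1 ⊗ ⋯ ⊗ φ ⊗ ⋯ ⊗ 1` (with `φ` at the place `a`) induced by the endomorphism
`φ` on families of components indexed by `ι → κ`. -/
def kroneckerSum (ι : Type*) [Fintype ι] [DecidableEq ι] :
    Matrix κ κ R →ₗ[R] Matrix (ι → κ) (ι → κ) R where
  toFun φ := ∑ a, piKronecker (Pi.mulSingle a φ)
  map_add' φ ψ := by
    ext i k
    simp [Matrix.sum_apply, Pi.mulSingle, piKronecker_update_apply, add_mul,
      Finset.sum_add_distrib]
  map_smul' r φ := by
    ext i k
    simp [Matrix.sum_apply, Pi.mulSingle, piKronecker_update_apply, Finset.mul_sum, mul_assoc]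

theorem kroneckerSum_eq_sum (φ : Matrix κ κ R) :
    kroneckerSum ι φ = ∑ a, piKronecker (Pi.mulSingle a φ) := rfl

theorem transpose_kroneckerSum (φ : Matrix κ κ R) :
    (kroneckerSum ι φ)ᵀ = kroneckerSum ι φᵀ := by
  simp only [kroneckerSum_eq_sum, transpose_sum, transpose_piKronecker]
  refine Finset.sum_congr rfl fun a _ => congrArg _ (funext fun b => ?_)
  obtain rfl | hb := eq_or_ne b a
  · simp
  · simp [hb]

theorem kroneckerSum_commutator (φ ψ : Matrix κ κ R) :
    kroneckerSum ι φ * kroneckerSum ι ψ - kroneckerSum ι ψ * kroneckerSum ι φ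
      = kroneckerSum ι (φ * ψ - ψ * φ) := by
  have same_place : ∀ (φ ψ : Matrix κ κ R) (a : ι), piKronecker (Pi.mulSingle a φ)
      * piKronecker (Pi.mulSingle a ψ) = piKronecker (Pi.mulSingle a (φ * ψ)) := fun φ ψ a => by
    rw [← map_mul, ← Pi.mulSingle_mul]
  have distinct_places : ∀ a b : ι, a ≠ b →
      piKronecker (Pi.mulSingle a φ) * piKronecker (Pi.mulSingle b ψ)
        - piKronecker (Pi.mulSingle b ψ) * piKronecker (Pi.mulSingle a φ) = 0 := fun a b hab => by
    have commute : Commute (Pi.mulSingle a φ : ι → Matrix κ κ R) (Pi.mulSingle b ψ) :=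
      Pi.mulSingle_commute (f := fun _ => Matrix κ κ R) hab φ ψ
    exact sub_eq_zero.2 (commute.map piKronecker).eq
  rw [map_sub]
  simp only [kroneckerSum_eq_sum, Finset.sum_mul_sum]
  rw [Finset.sum_comm (f := fun b a => piKronecker (Pi.mulSingle b ψ) * _),
    ← Finset.sum_sub_distrib, ← Finset.sum_sub_distrib]
  refine Finset.sum_congr rfl fun a _ => ?_
  rw [← Finset.sum_sub_distrib, Finset.sum_eq_single a (fun b _ hb => distinct_places a b hb.symm)
    (by simp), same_place, same_place]

theorem sum_piKronecker_mulSingle_mul (φ : Matrix κ κ R) (a : ι) (i : ι → κ) (C : (ι → κ) → R) :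
    ∑ k, piKronecker (Pi.mulSingle a φ) i k * C k
      = ∑ m, φ (i a) m * C (Function.update i a m) := by
  have off_place : ∀ k, k ∉ Set.range (Function.update i a) →
      piKronecker (Pi.mulSingle a φ) i k = 0 := fun k hk => by
    obtain ⟨b, hba, hb⟩ : ∃ b ≠ a, i b ≠ k b := by
      by_contra! h
      exact hk ⟨k a, Function.update_eq_iff.2 ⟨rfl, fun b hb => h b hb⟩⟩
    rw [Pi.mulSingle, piKronecker_update_apply, Finset.prod_eq_zero
      (Finset.mem_erase.2 ⟨hba, Finset.mem_univ b⟩) (by simp [hb]), mul_zero]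
  refine (Finset.sum_of_injOn (Function.update i a) (Function.update_injective i a).injOn
    (by simp) (fun k _ hk => ?_) fun m _ => ?_).symm
  · rw [off_place k (by simpa using hk), zero_mul]
  · rw [Pi.mulSingle, piKronecker_update_apply, Finset.prod_eq_one, Function.update_self, mul_one]
    exact fun b hb => by
      rw [Function.update_of_ne (Finset.ne_of_mem_erase hb), Pi.one_apply, one_apply_eq]

theorem kroneckerSum_mul_apply {m : Type*} (φ : Matrix κ κ R) (A : Matrix (ι → κ) m R)
    (i : ι → κ) (j : m) :
    (kroneckerSum ι φ * A) i j = ∑ a, ∑ m, φ (i a) m * A (Function.update i a m) j := by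
  rw [kroneckerSum_eq_sum, Matrix.sum_mul, Matrix.sum_apply]
  exact Finset.sum_congr rfl fun a _ => sum_piKronecker_mulSingle_mul φ a i fun k => A k j

theorem mul_kroneckerSum_apply {m : Type*} (φ : Matrix κ κ R) (A : Matrix m (ι → κ) R)
    (i : m) (j : ι → κ) :
    (A * kroneckerSum ι φ) i j = ∑ b, ∑ m, φ m (j b) * A i (Function.update j b m) := by
  have h := kroneckerSum_mul_apply φᵀ Aᵀ j i
  rwa [← transpose_kroneckerSum, ← transpose_mul] at h

theorem piKronecker_const_mul_kroneckerSum (S φ : Matrix κ κ R) :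
    piKronecker (fun _ : ι => S) * kroneckerSum ι φ
      = ∑ a, piKronecker (Function.update (fun _ => S) a (S * φ)) := by
  rw [kroneckerSum_eq_sum, Finset.mul_sum]
  refine Finset.sum_congr rfl fun a _ => ?_
  rw [← map_mul]
  refine congrArg _ (funext fun b => ?_)
  obtain rfl | hb := eq_or_ne b a
  · simp
  · simp [hb]

theorem kroneckerSum_transpose_mul_piKronecker_const (S φ : Matrix κ κ R) :
    (kroneckerSum ι φ)ᵀ * piKronecker (fun _ : ι => S)
      = ∑ a, piKronecker (Function.update (fun _ => S) a (φᵀ * S)) := by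
  rw [transpose_kroneckerSum, kroneckerSum_eq_sum, Finset.sum_mul]
  refine Finset.sum_congr rfl fun a _ => ?_
  rw [← map_mul]
  refine congrArg _ (funext fun b => ?_)
  obtain rfl | hb := eq_or_ne b a
  · simp
  · simp [hb]

theorem hasDerivAt_piKronecker_const {S : ℝ → Matrix κ κ ℝ} {φ : Matrix κ κ ℝ} {t : ℝ}
    (hS : HasDerivAt S (φᵀ * S t + S t * φ) t) :
    HasDerivAt (fun s => piKronecker fun _ : ι => S s)
      ((kroneckerSum ι φ)ᵀ * piKronecker (fun _ => S t)
        + piKronecker (fun _ => S t) * kroneckerSum ι φ) t := by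
  refine hasDerivAt_matrix_iff.2 fun i k => ?_
  refine (HasDerivAt.fun_finsetProd fun a (_ : a ∈ Finset.univ) =>
    hasDerivAt_matrix_iff.1 hS (i a) (k a)).congr_deriv ?_
  rw [kroneckerSum_transpose_mul_piKronecker_const, piKronecker_const_mul_kroneckerSum,
    ← Finset.sum_add_distrib, Matrix.sum_apply]
  refine Finset.sum_congr rfl fun a _ => ?_
  simp only [Matrix.add_apply, piKronecker_update_apply, smul_eq_mul]
  ring

end TensorPowers

/-! ### The tensor action of endomorphisms and the scalar product of tensors -/

section TensorAction

open Matrix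

variable {n p q : ℕ}

-- A family of components is a matrix with rows indexed by the upper and columns by the lower
-- multi-indices, on which `φ` acts by left and right multiplication.
theorem act_eq_mul (φ : Matrix (Fin n) (Fin n) ℝ) (A : Components n p q) :
    act φ A = kroneckerSum (Fin p) φ * of A - of A * kroneckerSum (Fin q) φ := by
  ext i j
  simp only [Matrix.sub_apply, kroneckerSum_mul_apply, mul_kroneckerSum_apply]
  rfl

theorem act_add (φ : Matrix (Fin n) (Fin n) ℝ) (A B : Components n p q) :
    act φ (A + B) = act φ A + act φ B := by
  funext i j
  simp only [act, Pi.add_apply, mul_add, Finset.sum_add_distrib]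
  ring

theorem act_zero (φ : Matrix (Fin n) (Fin n) ℝ) : act φ (0 : Components n p q) = 0 := by
  funext i j
  simp [act]

theorem add_act (φ ψ : Matrix (Fin n) (Fin n) ℝ) (A : Components n p q) :
    act (φ + ψ) A = act φ A + act ψ A := by
  funext i j
  simp only [act, Matrix.add_apply, Pi.add_apply, add_mul, Finset.sum_add_distrib]
  ring

theorem sub_act (φ ψ : Matrix (Fin n) (Fin n) ℝ) (A : Components n p q) :
    act (φ - ψ) A = act φ A - act ψ A := by
  funext i j
  simp only [act, Matrix.sub_apply, Pi.sub_apply, sub_mul, Finset.sum_sub_distrib]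
  ring

theorem smul_act (r : ℝ) (φ : Matrix (Fin n) (Fin n) ℝ) (A : Components n p q) :
    act (r • φ) A = r • act φ A := by
  funext i j
  simp only [act, Matrix.smul_apply, Pi.smul_apply, smul_eq_mul, mul_sub, Finset.mul_sum, mul_assoc]

theorem act_commutator (φ ψ : Matrix (Fin n) (Fin n) ℝ) (A : Components n p q) :
    act φ (act ψ A) - act ψ (act φ A) = act (φ * ψ - ψ * φ) A := by
  have hcomm (F F' : Matrix (Fin p → Fin n) (Fin p → Fin n) ℝ)
      (H H' : Matrix (Fin q → Fin n) (Fin q → Fin n) ℝ)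
      (B : Matrix (Fin p → Fin n) (Fin q → Fin n) ℝ) :
      F * (F' * B - B * H') - (F' * B - B * H') * H - (F' * (F * B - B * H) - (F * B - B * H) * H')
        = (F * F' - F' * F) * B - B * (H * H' - H' * H) := by
    simp only [Matrix.mul_sub, Matrix.sub_mul, Matrix.mul_assoc]
    abel
  rw [act_eq_mul (φ * ψ - ψ * φ), ← kroneckerSum_commutator, ← kroneckerSum_commutator, ← hcomm,
    act_eq_mul φ (act ψ A), act_eq_mul ψ (act φ A), act_eq_mul φ A, act_eq_mul ψ A]
  rfl

theorem hasDerivAt_act {φ : ℝ → Matrix (Fin n) (Fin n) ℝ} {φ' : Matrix (Fin n) (Fin n) ℝ}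
    {A : ℝ → Components n p q} {A' : Components n p q} {t : ℝ} (hφ : HasDerivAt φ φ' t)
    (hA : HasDerivAt A A' t) :
    HasDerivAt (fun s => act (φ s) (A s)) (act φ' (A t) + act (φ t) A') t := by
  have hφ := hasDerivAt_matrix_iff.1 hφ
  have hA := fun i j => hasDerivAt_pi.1 (hasDerivAt_pi.1 hA i) j
  refine hasDerivAt_pi.2 fun i => hasDerivAt_pi.2 fun j => ?_
  refine ((HasDerivAt.fun_sum fun a _ => HasDerivAt.fun_sum fun m _ =>
    (hφ (i a) m).mul (hA (Function.update i a m) j)).sub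
    (HasDerivAt.fun_sum fun b _ => HasDerivAt.fun_sum fun m _ =>
      (hφ m (j b)).mul (hA i (Function.update j b m)))).congr_deriv ?_
  simp only [Finset.sum_add_distrib, act, Pi.add_apply]
  ring

end TensorAction

section TensorForm

open Matrix

variable {ι ι' κ : Type*} [Fintype ι] [Fintype ι'] [DecidableEq ι] [DecidableEq ι'] [Fintype κ]
  [DecidableEq κ]

/-- The scalar product `S_{i_1 k_1} ⋯ S_{i_p k_p} S^{j_1 l_1} ⋯ S^{j_q l_q} A^{i…}_{j…} B^{k…}_{l…}`
of tensors, written with matrices whose rows and columns are indexed by the upper and lower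
multi-indices. -/
def tensorForm (S : Matrix κ κ ℝ) : LinearMap.BilinForm ℝ (Matrix (ι → κ) (ι' → κ) ℝ) :=
  LinearMap.mk₂ ℝ
    (fun A B : Matrix (ι → κ) (ι' → κ) ℝ =>
      trace (Aᵀ * piKronecker (fun _ : ι => S) * B * (piKronecker fun _ : ι' => S⁻¹)ᵀ))
    (fun A A' B => by simp [Matrix.add_mul]) (fun r A B => by simp)
    (fun A B B' => by simp [Matrix.mul_add, Matrix.add_mul]) (fun r A B => by simp)

theorem tensorForm_apply (S : Matrix κ κ ℝ) (A B : Matrix (ι → κ) (ι' → κ) ℝ) :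
    tensorForm S A B
      = trace (Aᵀ * piKronecker (fun _ : ι => S) * B * (piKronecker fun _ : ι' => S⁻¹)ᵀ) := rfl

theorem tensorForm_comm {S : Matrix κ κ ℝ} (hS : S.IsSymm) (A B : Matrix (ι → κ) (ι' → κ) ℝ) :
    tensorForm S A B = tensorForm S B A := by
  have hS' : (S⁻¹)ᵀ = S⁻¹ := by rw [transpose_nonsing_inv, hS]
  rw [tensorForm_apply, tensorForm_apply, ← trace_transpose, trace_mul_comm]
  simp only [transpose_mul, transpose_transpose, transpose_piKronecker, hS.eq, hS',
    Matrix.mul_assoc]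

theorem piKronecker_const_mul_inv {S : Matrix κ κ ℝ} (hS : IsUnit S.det) :
    piKronecker (fun _ : ι => S) * piKronecker (fun _ => S⁻¹) = 1 := by
  rw [← map_mul]
  simp only [Pi.mul_def, mul_nonsing_inv _ hS]
  exact map_one piKronecker

theorem eq_zero_of_tensorForm_eq_zero {S : Matrix κ κ ℝ} (hS : IsUnit S.det)
    {A : Matrix (ι → κ) (ι' → κ) ℝ} (h : ∀ B, tensorForm S A B = 0) : A = 0 := by
  have htrace : trace (Aᵀ * A) = 0 := by
    have hinv : (piKronecker fun _ : ι' => S)ᵀ * (piKronecker fun _ : ι' => S⁻¹)ᵀ = 1 := by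
      rw [← transpose_mul, mul_eq_one_comm.1 (piKronecker_const_mul_inv hS), transpose_one]
    rw [← h (piKronecker (fun _ : ι => S⁻¹) * A * (piKronecker fun _ : ι' => S)ᵀ),
      tensorForm_apply]
    simp only [Matrix.mul_assoc, hinv, Matrix.mul_one]
    rw [← Matrix.mul_assoc (piKronecker _) _ A, piKronecker_const_mul_inv hS, Matrix.one_mul]
  rwa [← conjTranspose_eq_transpose_of_trivial, trace_conjTranspose_mul_self_eq_zero_iff] at htrace

theorem hasDerivAt_tensorForm {S : ℝ → Matrix κ κ ℝ} {φ : Matrix κ κ ℝ}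
    {A B : ℝ → Matrix (ι → κ) (ι' → κ) ℝ} {A' B' : Matrix (ι → κ) (ι' → κ) ℝ} {t : ℝ}
    (hdet : IsUnit (S t).det) (hS : HasDerivAt S (φᵀ * S t + S t * φ) t)
    (hA : HasDerivAt A A' t) (hB : HasDerivAt B B' t) :
    HasDerivAt (fun s => tensorForm (S s) (A s) (B s))
      (tensorForm (S t) (A' + (kroneckerSum ι φ * A t - A t * kroneckerSum ι' φ)) (B t)
        + tensorForm (S t) (A t) (B' + (kroneckerSum ι φ * B t - B t * kroneckerSum ι' φ))) t := by
  have hinv : -((S t)⁻¹ * (φᵀ * S t + S t * φ) * (S t)⁻¹)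
      = (-φᵀ)ᵀ * (S t)⁻¹ + (S t)⁻¹ * (-φᵀ) := by
    rw [Matrix.mul_add, Matrix.add_mul, Matrix.mul_assoc (S t)⁻¹ (φᵀ * S t),
      Matrix.mul_assoc φᵀ, mul_nonsing_inv _ hdet, ← Matrix.mul_assoc _ (S t),
      nonsing_inv_mul _ hdet, transpose_neg, transpose_transpose]
    noncomm_ring
  have hP := hasDerivAt_piKronecker_const (ι := ι) hS
  have hQ := hasDerivAt_piKronecker_const (ι := ι') (hinv ▸ hasDerivAt_matrix_inv hS hdet)
  have hprod := hasDerivAt_matrix_mul (hasDerivAt_matrix_mul (hasDerivAt_matrix_mul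
    (hasDerivAt_matrix_transpose hA) hP) hB) (hasDerivAt_matrix_transpose hQ)
  refine (HasDerivAt.fun_sum fun i _ => hasDerivAt_matrix_iff.1 hprod i i).congr_deriv ?_
  have hcyc : trace ((kroneckerSum ι' φ)ᵀ * (A t)ᵀ * piKronecker (fun _ : ι => S t) * B t *
        (piKronecker fun _ : ι' => (S t)⁻¹)ᵀ)
      = trace ((A t)ᵀ * piKronecker (fun _ : ι => S t) * B t *
        (piKronecker fun _ : ι' => (S t)⁻¹)ᵀ * (kroneckerSum ι' φ)ᵀ) := by
    rw [trace_mul_comm _ (kroneckerSum ι' φ)ᵀ]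
    simp only [Matrix.mul_assoc]
  simp only [tensorForm_apply, transpose_add, transpose_sub, transpose_mul, transpose_transpose,
    Matrix.add_mul, Matrix.mul_add, Matrix.sub_mul, Matrix.mul_sub, trace_add, trace_sub, map_neg,
    transpose_neg, Matrix.mul_neg, Matrix.neg_mul, hcyc, ← transpose_kroneckerSum φ]
  change trace _ = _
  simp only [trace_add, trace_neg, ← Matrix.mul_assoc]
  ring

end TensorForm

section TensorInner

variable {n p q : ℕ} {M : Type*} [TopologicalSpace M] [ChartedSpace (EuclideanSpace ℝ (Fin n)) M]
  [IsManifold (𝓡 n) ∞ M]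

theorem tensorInner_eq_tensorForm (g : Metric n M)
    (e : OpenPartialHomeomorph M (EuclideanSpace ℝ (Fin n))) (x : Fin n → ℝ)
    (A B : Components n p q) :
    tensorInner g e x A B = tensorForm (metricMatrix g e x) (Matrix.of A) (Matrix.of B) := by
  simp only [tensorInner, tensorForm_apply, Matrix.trace, Matrix.diag_apply, Matrix.mul_apply,
    Finset.sum_mul, Matrix.transpose_apply, Matrix.of_apply, piKronecker_apply,
    ← Fintype.sum_prod_type']
  exact Fintype.sum_equiv
    ⟨fun (i, k, j, l) => (j, l, k, i), fun (j, l, k, i) => (i, k, j, l),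
      fun _ => rfl, fun _ => rfl⟩ _ _ fun (_, _, _, _) => by dsimp only [Equiv.coe_fn_mk]; ring

end TensorInner

/-! ### Charts of the base manifold -/

section Charts

open Matrix Topology

variable {n : ℕ} {M : Type*} [TopologicalSpace M]
  {e e' : OpenPartialHomeomorph M (EuclideanSpace ℝ (Fin n))} {x : Fin n → ℝ} {y : M}

/-- The range of the coordinates of the chart `e`. -/
def coordDomain (e : OpenPartialHomeomorph M (EuclideanSpace ℝ (Fin n))) : Set (Fin n → ℝ) :=
  {x | WithLp.toLp 2 x ∈ e.target}

theorem isOpen_coordDomain (e : OpenPartialHomeomorph M (EuclideanSpace ℝ (Fin n))) :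
    IsOpen (coordDomain e) :=
  e.open_target.preimage (PiLp.continuous_toLp 2 _)

theorem coord_mem_coordDomain (hy : y ∈ e.source) : coord e y ∈ coordDomain e :=
  e.map_source hy

theorem point_mem_source (hx : x ∈ coordDomain e) : point e x ∈ e.source :=
  e.map_target hx

theorem coord_point (hx : x ∈ coordDomain e) : coord e (point e x) = x :=
  congrArg (WithLp.ofLp (p := 2)) (e.right_inv hx)

theorem point_coord (hy : y ∈ e.source) : point e (coord e y) = y :=
  e.left_inv hy

/-- The change of coordinates from the chart `e` to the chart `e'`. -/
def transition (e e' : OpenPartialHomeomorph M (EuclideanSpace ℝ (Fin n))) (x : Fin n → ℝ) :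
    Fin n → ℝ :=
  coord e' (point e x)

theorem transition_mem_coordDomain (hx' : point e x ∈ e'.source) :
    transition e e' x ∈ coordDomain e' :=
  coord_mem_coordDomain hx'

theorem point_transition (hx' : point e x ∈ e'.source) :
    point e' (transition e e' x) = point e x :=
  point_coord hx'

theorem isOpen_transition_source (e e' : OpenPartialHomeomorph M (EuclideanSpace ℝ (Fin n))) :
    IsOpen {x | x ∈ coordDomain e ∧ point e x ∈ e'.source} :=
  (e.isOpen_inter_preimage_symm e'.open_source).preimage (PiLp.continuous_toLp 2 _)

variable [ChartedSpace (EuclideanSpace ℝ (Fin n)) M]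

/-- The derivative at `x` of the parametrization of `M` by the coordinates of `e`, taking `v` to
`v^i ∂_i`. The tangent spaces of `M` are all identified with the model space, as they are by
definition in Mathlib. -/
def frameMap (e : OpenPartialHomeomorph M (EuclideanSpace ℝ (Fin n))) (x : Fin n → ℝ) :
    (Fin n → ℝ) →L[ℝ] EuclideanSpace ℝ (Fin n) :=
  let D : EuclideanSpace ℝ (Fin n) →L[ℝ] EuclideanSpace ℝ (Fin n) :=
    mfderiv (𝓡 n) (𝓡 n) e.symm (WithLp.toLp 2 x)
  D ∘L (PiLp.continuousLinearEquiv 2 ℝ fun _ : Fin n => ℝ).symm.toContinuousLinearMap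

theorem frame_point (hx : x ∈ coordDomain e) (i : Fin n) :
    frame e (point e x) i = frameMap e x (Pi.single i 1) :=
  congrArg (fun u => frameMap e (WithLp.ofLp u) (Pi.single i 1)) (e.right_inv hx)

theorem mdifferentiable_of_mem_maximalAtlas (he : e ∈ IsManifold.maximalAtlas (𝓡 n) ∞ M) :
    e.MDifferentiable (𝓡 n) (𝓡 n) :=
  ⟨(contMDiffOn_of_mem_maximalAtlas he).mdifferentiableOn (by simp),
    (contMDiffOn_symm_of_mem_maximalAtlas he).mdifferentiableOn (by simp)⟩

theorem frameMap_injective (he : e ∈ IsManifold.maximalAtlas (𝓡 n) ∞ M) (hx : x ∈ coordDomain e) :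
    Function.Injective (frameMap e x) := by
  let L : EuclideanSpace ℝ (Fin n) →L[ℝ] EuclideanSpace ℝ (Fin n) :=
    mfderiv (𝓡 n) (𝓡 n) e (e.symm (WithLp.toLp 2 x))
  refine Function.LeftInverse.injective (g := fun u => WithLp.ofLp (L u)) fun v => ?_
  exact congrArg (fun K : EuclideanSpace ℝ (Fin n) →L[ℝ] EuclideanSpace ℝ (Fin n) =>
    WithLp.ofLp (K (WithLp.toLp 2 v)))
    ((mdifferentiable_of_mem_maximalAtlas he).comp_symm_deriv hx)

theorem contDiffAt_transition (he : e ∈ IsManifold.maximalAtlas (𝓡 n) ∞ M)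
    (he' : e' ∈ IsManifold.maximalAtlas (𝓡 n) ∞ M) (hx : x ∈ coordDomain e)
    (hx' : point e x ∈ e'.source) : ContDiffAt ℝ ∞ (transition e e') x := by
  have h := ((contMDiffOn_of_mem_maximalAtlas he').contMDiffAt
    (e'.open_source.mem_nhds hx')).comp (WithLp.toLp 2 x)
    ((contMDiffOn_symm_of_mem_maximalAtlas he).contMDiffAt (e.open_target.mem_nhds hx))
  exact PiLp.contDiff_ofLp.contDiffAt.comp x
    ((contMDiffAt_iff_contDiffAt.1 h).comp x PiLp.contDiff_toLp.contDiffAt)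

theorem contDiffAt_comp_point {f : M → ℝ} (hf : ContMDiff (𝓡 n) 𝓘(ℝ, ℝ) ∞ f)
    (he : e ∈ IsManifold.maximalAtlas (𝓡 n) ∞ M) (hx : x ∈ coordDomain e) :
    ContDiffAt ℝ ∞ (fun z => f (point e z)) x := by
  have h := hf.contMDiffAt.comp (WithLp.toLp 2 x)
    ((contMDiffOn_symm_of_mem_maximalAtlas he).contMDiffAt (e.open_target.mem_nhds hx))
  exact (contMDiffAt_iff_contDiffAt.1 h).comp x PiLp.contDiff_toLp.contDiffAt

theorem frameMap_transition (he : e ∈ IsManifold.maximalAtlas (𝓡 n) ∞ M)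
    (he' : e' ∈ IsManifold.maximalAtlas (𝓡 n) ∞ M) (hx : x ∈ coordDomain e)
    (hx' : point e x ∈ e'.source) (v : Fin n → ℝ) :
    frameMap e' (transition e e' x) (fderiv ℝ (transition e e') x v) = frameMap e x v := by
  let ψ := PiLp.continuousLinearEquiv 2 ℝ fun _ : Fin n => ℝ
  let u : EuclideanSpace ℝ (Fin n) := WithLp.toLp 2 x
  have htrans : MDifferentiableAt (𝓡 n) (𝓡 n) (e' ∘ e.symm) u :=
    ((mdifferentiable_of_mem_maximalAtlas he').mdifferentiableAt (x := e.symm u) hx').comp u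
      ((mdifferentiable_of_mem_maximalAtlas he).mdifferentiableAt_symm hx)
  have hderiv : fderiv ℝ (transition e e') x v = ψ (fderiv ℝ (e' ∘ e.symm) u (ψ.symm v)) := by
    have h : HasFDerivAt (transition e e') _ x := ψ.hasFDerivAt.comp x
      ((mdifferentiableAt_iff_differentiableAt.1 htrans).hasFDerivAt.comp x ψ.symm.hasFDerivAt)
    rw [h.fderiv]
    rfl
  have hsymm : e'.symm ∘ e' ∘ e.symm =ᶠ[𝓝 u] e.symm := by
    filter_upwards [(e.isOpen_inter_preimage_symm e'.open_source).mem_nhds ⟨hx, hx'⟩] with z hz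
    exact e'.left_inv hz.2
  have hchain := mfderiv_comp (I := 𝓡 n) (I' := 𝓡 n) (I'' := 𝓡 n) u
    ((mdifferentiable_of_mem_maximalAtlas he').mdifferentiableAt_symm
      (transition_mem_coordDomain hx')) htrans
  rw [hsymm.mfderiv_eq, mfderiv_eq_fderiv] at hchain
  rw [hderiv]
  exact (congrArg (fun K : EuclideanSpace ℝ (Fin n) →L[ℝ] EuclideanSpace ℝ (Fin n) =>
    K (ψ.symm v)) hchain).symm

end Charts

section MetricMatrix

open Matrix

variable {n : ℕ} {M : Type*} [TopologicalSpace M] [ChartedSpace (EuclideanSpace ℝ (Fin n)) M]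
  [IsManifold (𝓡 n) ∞ M] (g : Metric n M)
  {e e' : OpenPartialHomeomorph M (EuclideanSpace ℝ (Fin n))} {x : Fin n → ℝ}

/-- The metric at `y`, as a bilinear form on the model space. -/
def modelInner (y : M) :
    EuclideanSpace ℝ (Fin n) →L[ℝ] EuclideanSpace ℝ (Fin n) →L[ℝ] ℝ :=
  g.inner y

theorem dotProduct_metricMatrix_mulVec (hx : x ∈ coordDomain e) (v w : Fin n → ℝ) :
    v ⬝ᵥ metricMatrix g e x *ᵥ w
      = modelInner g (point e x) (frameMap e x v) (frameMap e x w) := by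
  let B : (Fin n → ℝ) →ₗ[ℝ] (Fin n → ℝ) →ₗ[ℝ] ℝ :=
    LinearMap.mk₂ ℝ (fun v w => modelInner g (point e x) (frameMap e x v) (frameMap e x w))
      (by simp) (by simp) (by simp) (by simp)
  have hB : metricMatrix g e x = LinearMap.toMatrix₂' ℝ B := by
    ext i j
    change modelInner g (point e x) (frame e (point e x) i) (frame e (point e x) j) = _
    rw [frame_point hx, frame_point hx, LinearMap.toMatrix₂'_apply, LinearMap.mk₂_apply]
  rw [hB, ← Matrix.toLinearMap₂'_apply', Matrix.toLinearMap₂'_toMatrix', LinearMap.mk₂_apply]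

theorem metricMatrix_isSymm (e : OpenPartialHomeomorph M (EuclideanSpace ℝ (Fin n)))
    (x : Fin n → ℝ) : (metricMatrix g e x).IsSymm :=
  Matrix.IsSymm.ext fun _ _ => g.symm _ _ _

theorem dotProduct_metricMatrix_mulVec_pos (he : e ∈ IsManifold.maximalAtlas (𝓡 n) ∞ M)
    (hx : x ∈ coordDomain e) {v : Fin n → ℝ} (hv : v ≠ 0) : 0 < v ⬝ᵥ metricMatrix g e x *ᵥ v := by
  rw [dotProduct_metricMatrix_mulVec g hx]
  exact g.pos _ _ ((map_ne_zero_iff _ (frameMap_injective he hx)).2 hv)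

theorem isUnit_det_metricMatrix (he : e ∈ IsManifold.maximalAtlas (𝓡 n) ∞ M)
    (hx : x ∈ coordDomain e) : IsUnit (metricMatrix g e x).det := by
  have hpos : (metricMatrix g e x).PosDef := .of_dotProduct_mulVec_pos
    (metricMatrix_isSymm g e x) fun _ hv => dotProduct_metricMatrix_mulVec_pos g he hx hv
  exact hpos.det_pos.ne'.isUnit

theorem contMDiffAt_mfderiv_symm (he : e ∈ IsManifold.maximalAtlas (𝓡 n) ∞ M)
    (v : EuclideanSpace ℝ (Fin n)) {u : EuclideanSpace ℝ (Fin n)} (hu : u ∈ e.target) :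
    ContMDiffAt (𝓡 n) (𝓡 n).tangent ∞
      (fun u => (⟨e.symm u, mfderiv (𝓡 n) (𝓡 n) e.symm u v⟩ : TangentBundle (𝓡 n) M)) u := by
  have hmap := (contMDiffOn_symm_of_mem_maximalAtlas he).contMDiffOn_tangentMapWithin (m := ∞)
    (by simp) e.open_target.uniqueMDiffOn
  have hsection : ContMDiffAt (𝓡 n) (𝓡 n).tangent ∞
      (fun u => (⟨u, v⟩ : TangentBundle (𝓡 n) (EuclideanSpace ℝ (Fin n)))) u :=
    contMDiffAt_vectorSpace_iff_contDiffAt.2 contDiffAt_const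
  refine ((hmap.contMDiffAt (x := ⟨u, v⟩) ((e.open_target.preimage
    (FiberBundle.continuous_proj _ _)).mem_nhds hu)).comp u hsection).congr_of_eventuallyEq ?_
  filter_upwards [e.open_target.mem_nhds hu] with w hw
  simp only [Function.comp, tangentMapWithin]
  rw [mfderivWithin_of_isOpen e.open_target hw]

theorem contDiffAt_metricMatrix (he : e ∈ IsManifold.maximalAtlas (𝓡 n) ∞ M)
    (hx : x ∈ coordDomain e) (i j : Fin n) :
    ContDiffAt ℝ ∞ (fun z => metricMatrix g e z i j) x := by
  have h : ContMDiffAt (𝓡 n) ((𝓡 n).prod 𝓘(ℝ, ℝ)) ∞ (fun u : EuclideanSpace ℝ (Fin n) =>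
      Bundle.TotalSpace.mk' ℝ (E := Bundle.Trivial M ℝ) (e.symm u)
      (g.inner (e.symm u) (mfderiv (𝓡 n) (𝓡 n) e.symm u (EuclideanSpace.single i 1))
        (mfderiv (𝓡 n) (𝓡 n) e.symm u (EuclideanSpace.single j 1)))) (WithLp.toLp 2 x) :=
    ContMDiffAt.clm_bundle_apply₂ (F₁ := EuclideanSpace ℝ (Fin n))
      (F₂ := EuclideanSpace ℝ (Fin n)) (g.contMDiff.contMDiffAt.comp _
        ((contMDiffOn_symm_of_mem_maximalAtlas he).contMDiffAt (e.open_target.mem_nhds hx)))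
      (contMDiffAt_mfderiv_symm he _ hx) (contMDiffAt_mfderiv_symm he _ hx)
  refine ((contMDiffAt_iff_contDiffAt.1 (Bundle.contMDiffAt_totalSpace.1 h).2).comp x
    PiLp.contDiff_toLp.contDiffAt).congr_of_eventuallyEq ?_
  filter_upwards [(isOpen_coordDomain e).mem_nhds hx] with z hz
  change modelInner g (point e z) (frame e (point e z) i) (frame e (point e z) j) = _
  rw [frame_point hz, frame_point hz, modelInner]
  rfl

theorem dotProduct_metricMatrix_mulVec_transition (he : e ∈ IsManifold.maximalAtlas (𝓡 n) ∞ M)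
    (he' : e' ∈ IsManifold.maximalAtlas (𝓡 n) ∞ M) (hx : x ∈ coordDomain e)
    (hx' : point e x ∈ e'.source) (v w : Fin n → ℝ) :
    v ⬝ᵥ metricMatrix g e x *ᵥ w
      = fderiv ℝ (transition e e') x v ⬝ᵥ metricMatrix g e' (transition e e' x) *ᵥ
        fderiv ℝ (transition e e') x w := by
  rw [dotProduct_metricMatrix_mulVec g hx,
    dotProduct_metricMatrix_mulVec g (transition_mem_coordDomain hx'),
    frameMap_transition he he' hx hx', frameMap_transition he he' hx hx', point_transition hx']

end MetricMatrix

/-! ### Curvature and covariant derivatives of tensors -/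

section Curvature

open Matrix

variable {κ : Type*} [Fintype κ] {Γ : (κ → ℝ) → κ → κ → κ → ℝ}

theorem hasDerivAt_connectionMatrix {x ξ : ℝ → κ → ℝ} {u ξ' : κ → ℝ} {t : ℝ}
    (hΓ : ∀ c a b, DifferentiableAt ℝ (fun z => Γ z c a b) (x t)) (hx : HasDerivAt x u t)
    (hξ : HasDerivAt ξ ξ' t) :
    HasDerivAt (fun s => connectionMatrix (Γ (x s)) (ξ s))
      (matrixDeriv (fun z => connectionMatrix (Γ z) (ξ t)) (x t) u
        + connectionMatrix (Γ (x t)) ξ') t := by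
  refine hasDerivAt_matrix_iff.2 fun k m => ?_
  have hfixed (a) : HasFDerivAt (fun z => ξ t a * Γ z k a m) _ (x t) :=
    (hΓ k a m).hasFDerivAt.const_mul (ξ t a)
  have hmatrix : matrixDeriv (fun z => connectionMatrix (Γ z) (ξ t)) (x t) u k m
      = ∑ a, ξ t a * fderiv ℝ (fun z => Γ z k a m) (x t) u := by
    change fderiv ℝ (fun z => ∑ a, ξ t a * Γ z k a m) (x t) u = _
    rw [(HasFDerivAt.fun_sum fun a _ => hfixed a).fderiv]
    simp
  rw [Matrix.add_apply, hmatrix, connectionMatrix_apply, ← Finset.sum_add_distrib]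
  simp only [connectionMatrix_apply, add_comm (ξ t _ * _)]
  exact HasDerivAt.fun_sum fun a _ => (hasDerivAt_pi.1 hξ a).mul
    ((hΓ k a m).hasFDerivAt.comp_hasDerivAt t hx)

variable [DecidableEq κ]

/-- The curvature endomorphism `R(u,v)`, with entry `u^l v^r R_{lrm}^k` in row `k` and
column `m`. -/
def curvatureMatrix (Γ : (κ → ℝ) → κ → κ → κ → ℝ) (z u v : κ → ℝ) : Matrix κ κ ℝ :=
  ∑ l, ∑ r, (u l * v r) • Matrix.of fun k m => curvature Γ z l r m k

theorem curvatureMatrix_eq {z : κ → ℝ} (hΓ : ∀ c a b, DifferentiableAt ℝ (fun z => Γ z c a b) z)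
    (u v : κ → ℝ) :
    curvatureMatrix Γ z u v
      = matrixDeriv (fun y => connectionMatrix (Γ y) v) z u
        - matrixDeriv (fun y => connectionMatrix (Γ y) u) z v
        + (connectionMatrix (Γ z) u * connectionMatrix (Γ z) v
          - connectionMatrix (Γ z) v * connectionMatrix (Γ z) u) := by
  ext k m
  have hderiv (u v : κ → ℝ) : matrixDeriv (fun y => connectionMatrix (Γ y) v) z u k m
      = ∑ l, ∑ r, u l * v r * pd l (fun y => Γ y k r m) z := by
    have hfixed (r) : HasFDerivAt (fun y => v r * Γ y k r m) _ z :=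
      (hΓ k r m).hasFDerivAt.const_mul (v r)
    simp only [matrixDeriv_apply_apply, pd, connectionMatrix_apply]
    rw [(HasFDerivAt.fun_sum fun r _ => hfixed r).fderiv]
    simp [Finset.mul_sum, mul_assoc]
  have hmul (u v : κ → ℝ) : (connectionMatrix (Γ z) u * connectionMatrix (Γ z) v) k m
      = ∑ l, ∑ r, u l * v r * ∑ s, Γ z k l s * Γ z s r m := by
    simp only [mul_apply, connectionMatrix_apply, Finset.mul_sum, Finset.sum_mul]
    rw [Finset.sum_comm_cycle]
    refine Finset.sum_congr rfl fun l _ => ?_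
    rw [Finset.sum_comm]
    exact Finset.sum_congr rfl fun r _ => Finset.sum_congr rfl fun s _ => by ring
  simp only [curvatureMatrix, Matrix.sum_apply, Matrix.add_apply, Matrix.sub_apply,
    Matrix.smul_apply, Matrix.of_apply, hderiv, hmul, curvature, smul_eq_mul]
  rw [Finset.sum_comm (f := fun l r => v l * u r * pd l _ z),
    Finset.sum_comm (f := fun l r => v l * u r * ∑ s, _)]
  simp only [← Finset.sum_sub_distrib, ← Finset.sum_add_distrib]
  refine Finset.sum_congr rfl fun l _ => Finset.sum_congr rfl fun r _ => ?_
  rw [Finset.sum_sub_distrib]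
  ring

end Curvature

/-! ### The rescaled Sasaki type metric -/

section SasakiMatrix

open Matrix

variable {n p q : ℕ} {M : Type*} [TopologicalSpace M]
  [ChartedSpace (EuclideanSpace ℝ (Fin n)) M] [IsManifold (𝓡 n) ∞ M]
  {g : Metric n M} {f : M → ℝ} {e : OpenPartialHomeomorph M (EuclideanSpace ℝ (Fin n))}

/-- The components of the conformal metric `f g` in the chart `e`. -/
def scaledMatrix (g : Metric n M) (f : M → ℝ)
    (e : OpenPartialHomeomorph M (EuclideanSpace ℝ (Fin n))) (x : Fin n → ℝ) :
    Matrix (Fin n) (Fin n) ℝ :=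
  f (point e x) • metricMatrix g e x

theorem dotProduct_scaledMatrix_mulVec (x v w : Fin n → ℝ) :
    v ⬝ᵥ scaledMatrix g f e x *ᵥ w = f (point e x) * (v ⬝ᵥ metricMatrix g e x *ᵥ w) := by
  rw [scaledMatrix, smul_mulVec, dotProduct_smul, smul_eq_mul]

theorem scaledMatrix_isSymm (x : Fin n → ℝ) : (scaledMatrix g f e x).IsSymm :=
  (metricMatrix_isSymm g e x).smul _

theorem isUnit_det_scaledMatrix (he : e ∈ IsManifold.maximalAtlas (𝓡 n) ∞ M) (hf₀ : ∀ y, f y ≠ 0)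
    {x : Fin n → ℝ} (hx : x ∈ coordDomain e) : IsUnit (scaledMatrix g f e x).det := by
  rw [scaledMatrix, det_smul]
  exact ((hf₀ _).isUnit.pow _).mul (isUnit_det_metricMatrix g he hx)

theorem contDiffAt_scaledMatrix (he : e ∈ IsManifold.maximalAtlas (𝓡 n) ∞ M)
    (hf : ContMDiff (𝓡 n) 𝓘(ℝ, ℝ) ∞ f) {x : Fin n → ℝ} (hx : x ∈ coordDomain e) (i j : Fin n) :
    ContDiffAt ℝ ∞ (fun z => scaledMatrix g f e z i j) x :=
  (contDiffAt_comp_point hf he hx).mul (contDiffAt_metricMatrix g he hx i j)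

theorem verticalPart_eq (z v : Idx n p q → ℝ) : verticalPart g e z v = fibrePart v
    + act (connectionMatrix (baseChristoffel g e (basePart z)) (basePart v)) (fibrePart z) := rfl

theorem verticalPart_add (z v w : Idx n p q → ℝ) :
    verticalPart g e z (v + w) = verticalPart g e z v + verticalPart g e z w := by
  have hb : basePart (v + w) = basePart v + basePart w := rfl
  have hf : fibrePart (v + w) = fibrePart v + fibrePart w := rfl
  simp only [verticalPart_eq, hb, hf, map_add, add_act]
  abel

theorem verticalPart_smul (z : Idx n p q → ℝ) (r : ℝ) (v : Idx n p q → ℝ) :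
    verticalPart g e z (r • v) = r • verticalPart g e z v := by
  have hb : basePart (r • v) = r • basePart v := rfl
  have hf : fibrePart (r • v) = r • fibrePart v := rfl
  simp only [verticalPart_eq, hb, hf, map_smul, smul_act, smul_add]

theorem verticalPart_zero (z : Idx n p q → ℝ) : verticalPart g e z 0 = 0 := by
  rw [← zero_smul ℝ (0 : Idx n p q → ℝ), verticalPart_smul, zero_smul]

theorem eq_of_basePart_eq_of_verticalPart_eq {z v w : Idx n p q → ℝ}
    (hb : basePart v = basePart w) (hv : verticalPart g e z v = verticalPart g e z w) :
    v = w := by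
  rw [verticalPart_eq, verticalPart_eq, hb, add_left_inj] at hv
  funext c
  rcases c with i | ⟨i, j⟩
  · exact congrFun hb i
  · exact congrFun (congrFun hv i) j

theorem basePart_horizontalLift_add_verticalLift (z : Idx n p q → ℝ) (ξ : Fin n → ℝ)
    (A : Components n p q) : basePart (horizontalLift g e z ξ + verticalLift A) = ξ :=
  add_zero ξ

theorem verticalPart_horizontalLift_add_verticalLift (z : Idx n p q → ℝ) (ξ : Fin n → ℝ)
    (A : Components n p q) :
    verticalPart g e z (horizontalLift g e z ξ + verticalLift A) = A := by
  rw [verticalPart_add, verticalPart_horizontalLift, verticalPart_verticalLift, zero_add]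

theorem sasaki_eq (z v w : Idx n p q → ℝ) : sasaki g f e z v w
    = basePart v ⬝ᵥ scaledMatrix g f e (basePart z) *ᵥ basePart w
      + tensorInner g e (basePart z) (verticalPart g e z v) (verticalPart g e z w) := by
  rw [dotProduct_scaledMatrix_mulVec, dotProduct_mulVec_eq_sum]
  rfl

theorem sasaki_comm (z v w : Idx n p q → ℝ) : sasaki g f e z v w = sasaki g f e z w v := by
  rw [sasaki_eq, sasaki_eq, dotProduct_mulVec_comm (scaledMatrix_isSymm _),
    tensorInner_eq_tensorForm, tensorForm_comm (metricMatrix_isSymm g e _),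
    tensorInner_eq_tensorForm]

theorem sasaki_add_left (z v v' w : Idx n p q → ℝ) :
    sasaki g f e z (v + v') w = sasaki g f e z v w + sasaki g f e z v' w := by
  have hb : basePart (v + v') = basePart v + basePart v' := rfl
  simp only [sasaki_eq, hb, add_dotProduct, verticalPart_add, tensorInner_eq_tensorForm,
    ← of_add_of, map_add, LinearMap.add_apply]
  ring

theorem sasaki_smul_left (z : Idx n p q → ℝ) (r : ℝ) (v w : Idx n p q → ℝ) :
    sasaki g f e z (r • v) w = r * sasaki g f e z v w := by
  have hb : basePart (r • v) = r • basePart v := rfl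
  simp only [sasaki_eq, hb, smul_dotProduct, verticalPart_smul, tensorInner_eq_tensorForm,
    ← smul_of, map_smul, LinearMap.smul_apply, smul_eq_mul, mul_add]

theorem dotProduct_sasakiMatrix_mulVec (z v w : Idx n p q → ℝ) :
    v ⬝ᵥ sasakiMatrix g f e z *ᵥ w = sasaki g f e z v w := by
  let B : (Idx n p q → ℝ) →ₗ[ℝ] (Idx n p q → ℝ) →ₗ[ℝ] ℝ :=
    LinearMap.mk₂ ℝ (sasaki g f e z) (sasaki_add_left z) (sasaki_smul_left z)
      (fun v w w' => by simp only [sasaki_comm z v, sasaki_add_left])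
      (fun r v w => by simp only [sasaki_comm z v, sasaki_smul_left, smul_eq_mul])
  have hB : sasakiMatrix g f e z = LinearMap.toMatrix₂' ℝ B := by
    ext a b
    rw [LinearMap.toMatrix₂'_apply, LinearMap.mk₂_apply, sasakiMatrix]
  rw [hB, ← Matrix.toLinearMap₂'_apply', Matrix.toLinearMap₂'_toMatrix', LinearMap.mk₂_apply]

theorem sasakiMatrix_isSymm (z : Idx n p q → ℝ) : (sasakiMatrix g f e z).IsSymm :=
  Matrix.IsSymm.ext fun _ _ => sasaki_comm _ _ _

theorem eq_zero_of_tensorInner_eq_zero (he : e ∈ IsManifold.maximalAtlas (𝓡 n) ∞ M)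
    {x : Fin n → ℝ} (hx : x ∈ coordDomain e) {A : Components n p q}
    (hA : ∀ B : Components n p q, tensorInner g e x A B = 0) : A = 0 := by
  have h : of A = 0 :=
    eq_zero_of_tensorForm_eq_zero (isUnit_det_metricMatrix g he hx) fun B => by
      rw [← hA (of.symm B), tensorInner_eq_tensorForm, Equiv.apply_symm_apply]
  exact of.injective (h.trans of_zero.symm)

theorem isUnit_det_sasakiMatrix (he : e ∈ IsManifold.maximalAtlas (𝓡 n) ∞ M)
    (hf₀ : ∀ y, f y ≠ 0) {z : Idx n p q → ℝ} (hz : basePart z ∈ coordDomain e) :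
    IsUnit (sasakiMatrix g f e z).det := by
  suffices (sasakiMatrix g f e z).SeparatingLeft from
    (separatingLeft_iff_det_ne_zero.1 this).isUnit
  refine separatingLeft_def.2 fun v hv => ?_
  simp only [dotProduct_sasakiMatrix_mulVec] at hv
  have hb : basePart v = 0 := by
    refine (nondegenerate_of_det_ne_zero
      (isUnit_det_scaledMatrix (g := g) he hf₀ hz).ne_zero).eq_zero_of_ortho fun ξ => ?_
    have h := hv (horizontalLift g e z ξ)
    rw [sasaki_eq, verticalPart_horizontalLift] at h
    simpa [tensorInner, horizontalLift, basePart_mkIdx] using h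
  have hv : verticalPart g e z v = 0 := by
    refine eq_zero_of_tensorInner_eq_zero (g := g) he hz fun A => ?_
    have h := hv (verticalLift A)
    rwa [sasaki_eq, verticalPart_verticalLift, hb, zero_dotProduct, zero_add] at h
  exact eq_of_basePart_eq_of_verticalPart_eq hb (hv.trans (verticalPart_zero z).symm)

end SasakiMatrix

section BundleConnection

open Matrix

variable {n p q : ℕ} {M : Type*} [TopologicalSpace M]
  [ChartedSpace (EuclideanSpace ℝ (Fin n)) M] [IsManifold (𝓡 n) ∞ M]
  {g : Metric n M} {f : M → ℝ} {e : OpenPartialHomeomorph M (EuclideanSpace ℝ (Fin n))}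

theorem contDiffAt_baseChristoffel (he : e ∈ IsManifold.maximalAtlas (𝓡 n) ∞ M)
    {x : Fin n → ℝ} (hx : x ∈ coordDomain e) (k i j : Fin n) :
    ContDiffAt ℝ ∞ (fun y => baseChristoffel g e y k i j) x :=
  contDiffAt_christoffel (contDiffAt_metricMatrix g he hx) (isUnit_det_metricMatrix g he hx) k i j

theorem differentiableAt_baseChristoffel (he : e ∈ IsManifold.maximalAtlas (𝓡 n) ∞ M)
    {x : Fin n → ℝ} (hx : x ∈ coordDomain e) (k i j : Fin n) :
    DifferentiableAt ℝ (fun y => baseChristoffel g e y k i j) x :=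
  (contDiffAt_baseChristoffel he hx k i j).differentiableAt (by simp)

theorem contDiff_basePart {r : WithTop ℕ∞} :
    ContDiff ℝ r (basePart : (Idx n p q → ℝ) → Fin n → ℝ) :=
  contDiff_pi.2 fun i => contDiff_apply ℝ ℝ (Sum.inl i)

theorem contDiffAt_verticalPart (he : e ∈ IsManifold.maximalAtlas (𝓡 n) ∞ M)
    {z : Idx n p q → ℝ} (hz : basePart z ∈ coordDomain e) (v : Idx n p q → ℝ)
    (i : Fin p → Fin n) (j : Fin q → Fin n) :
    ContDiffAt ℝ ∞ (fun z => verticalPart g e z v i j) z := by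
  have hconn (k m) : ContDiffAt ℝ ∞ (fun z : Idx n p q → ℝ =>
      connectionMatrix (baseChristoffel g e (basePart z)) (basePart v) k m) z := by
    simp only [connectionMatrix_apply]
    exact ContDiffAt.sum fun l _ => contDiffAt_const.mul
      ((contDiffAt_baseChristoffel he hz k l m).comp z contDiff_basePart.contDiffAt)
  have hfibre (i j) : ContDiffAt ℝ ∞ (fun z : Idx n p q → ℝ => fibrePart z i j) z :=
    (contDiff_apply ℝ ℝ (Sum.inr (i, j))).contDiffAt
  exact contDiffAt_const.add ((ContDiffAt.sum fun a _ => ContDiffAt.sum fun m _ =>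
    (hconn _ _).mul (hfibre _ _)).sub (ContDiffAt.sum fun a _ => ContDiffAt.sum fun m _ =>
    (hconn _ _).mul (hfibre _ _)))

theorem contDiffAt_tensorInner {E : Type*} [NormedAddCommGroup E] [NormedSpace ℝ E]
    (he : e ∈ IsManifold.maximalAtlas (𝓡 n) ∞ M) {x : E → Fin n → ℝ}
    {A B : E → Components n p q} {z : E} (hz : x z ∈ coordDomain e) (hx : ContDiffAt ℝ ∞ x z)
    (hA : ∀ i j, ContDiffAt ℝ ∞ (fun z => A z i j) z)
    (hB : ∀ i j, ContDiffAt ℝ ∞ (fun z => B z i j) z) :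
    ContDiffAt ℝ ∞ (fun z => tensorInner g e (x z) (A z) (B z)) z := by
  have hG (a b) : ContDiffAt ℝ ∞ (fun z => metricMatrix g e (x z) a b) z :=
    (contDiffAt_metricMatrix g he hz a b).comp z hx
  exact ContDiffAt.sum fun i _ => ContDiffAt.sum fun k _ => ContDiffAt.sum fun j _ =>
    ContDiffAt.sum fun l _ => (((contDiffAt_prod fun a _ => hG _ _).mul
      (contDiffAt_prod fun b _ => contDiffAt_matrix_inv_apply hG
        (isUnit_det_metricMatrix g he hz) _ _)).mul (hA i j)).mul (hB k l)

theorem contDiffAt_sasakiMatrix (he : e ∈ IsManifold.maximalAtlas (𝓡 n) ∞ M)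
    (hf : ContMDiff (𝓡 n) 𝓘(ℝ, ℝ) ∞ f) {z : Idx n p q → ℝ} (hz : basePart z ∈ coordDomain e)
    (a b : Idx n p q) : ContDiffAt ℝ ∞ (fun z => sasakiMatrix g f e z a b) z := by
  simp only [sasakiMatrix, sasaki_eq, dotProduct_mulVec_eq_sum]
  refine (ContDiffAt.sum fun i _ => ContDiffAt.sum fun j _ =>
    (((contDiffAt_scaledMatrix he hf hz i j).comp z contDiff_basePart.contDiffAt).mul
      contDiffAt_const).mul contDiffAt_const).add ?_
  exact contDiffAt_tensorInner he hz contDiff_basePart.contDiffAt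
    (contDiffAt_verticalPart he hz _) (contDiffAt_verticalPart he hz _)

theorem hasDerivAt_basePart {X : ℝ → Idx n p q → ℝ} {u : Idx n p q → ℝ} {t : ℝ}
    (hX : HasDerivAt X u t) : HasDerivAt (fun s => basePart (X s)) (basePart u) t :=
  hasDerivAt_pi.2 fun i => hasDerivAt_pi.1 hX (Sum.inl i)

theorem hasDerivAt_fibrePart {X : ℝ → Idx n p q → ℝ} {u : Idx n p q → ℝ} {t : ℝ}
    (hX : HasDerivAt X u t) : HasDerivAt (fun s => fibrePart (X s)) (fibrePart u) t :=
  hasDerivAt_pi.2 fun i => hasDerivAt_pi.2 fun j => hasDerivAt_pi.1 hX (Sum.inr (i, j))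

theorem hasDerivAt_verticalPart (he : e ∈ IsManifold.maximalAtlas (𝓡 n) ∞ M)
    {X W : ℝ → Idx n p q → ℝ} {u W' : Idx n p q → ℝ} {t : ℝ}
    (ht : basePart (X t) ∈ coordDomain e) (hX : HasDerivAt X u t) (hW : HasDerivAt W W' t) :
    HasDerivAt (fun s => verticalPart g e (X s) (W s))
      (fibrePart W' + (act (matrixDeriv (fun y => connectionMatrix (baseChristoffel g e y)
          (basePart (W t))) (basePart (X t)) (basePart u)
          + connectionMatrix (baseChristoffel g e (basePart (X t))) (basePart W'))
          (fibrePart (X t))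
        + act (connectionMatrix (baseChristoffel g e (basePart (X t))) (basePart (W t)))
          (fibrePart u))) t :=
  (hasDerivAt_fibrePart hW).add (hasDerivAt_act
    (hasDerivAt_connectionMatrix (x := fun s => basePart (X s))
      (differentiableAt_baseChristoffel he ht) (hasDerivAt_basePart hX) (hasDerivAt_basePart hW))
    (hasDerivAt_fibrePart hX))

theorem hasDerivAt_tensorInner (he : e ∈ IsManifold.maximalAtlas (𝓡 n) ∞ M)
    {x : ℝ → Fin n → ℝ} {A B : ℝ → Components n p q} {u : Fin n → ℝ} {A' B' : Components n p q}
    {t : ℝ} (ht : x t ∈ coordDomain e) (hx : HasDerivAt x u t) (hA : HasDerivAt A A' t)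
    (hB : HasDerivAt B B' t) :
    HasDerivAt (fun s => tensorInner g e (x s) (A s) (B s))
      (tensorInner g e (x t) (A' + connectionTerm g e (x t) u (A t)) (B t)
        + tensorInner g e (x t) (A t) (B' + connectionTerm g e (x t) u (B t))) t := by
  have hG : ∀ a b, DifferentiableAt ℝ (fun y => metricMatrix g e y a b) (x t) :=
    fun a b => (contDiffAt_metricMatrix g he ht a b).differentiableAt (by simp)
  have hS := hasDerivAt_matrix_comp hG hx
  rw [matrixDeriv_eq_metricConnection (metricMatrix_isSymm g e) (T := 0)
    (by simp) (isUnit_det_metricMatrix g he ht), metricConnection_zero] at hS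
  have hA : HasDerivAt (fun s => of (A s)) (of A') t := hA
  have hB : HasDerivAt (fun s => of (B s)) (of B') t := hB
  have h := hasDerivAt_tensorForm (isUnit_det_metricMatrix g he ht) hS hA hB
  simp only [← act_eq_mul] at h
  simp only [tensorInner_eq_tensorForm]
  exact h

theorem torsion_antisymm (z : Idx n p q → ℝ) (c a b : Idx n p q) :
    torsion g e z c a b = -torsion g e z c b a := by
  rcases c with c | ⟨i, j⟩ <;> rcases a with a | a <;> rcases b with b | b <;>
    simp only [torsion, neg_zero]
  have hcurv : (fun k m => curvature (baseChristoffel g e) (basePart z) b a m k)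
      = -fun k m => curvature (baseChristoffel g e) (basePart z) a b m k := by
    funext k m
    simp only [curvature, Pi.neg_apply, Finset.sum_sub_distrib]
    ring
  have h := congrFun (congrFun (smul_act (-1) (of fun k m =>
    curvature (baseChristoffel g e) (basePart z) a b m k) (fibrePart z)) i) j
  rw [neg_one_smul, neg_one_smul] at h
  rw [hcurv, ← neg_eq_iff_eq_neg]
  exact h.symm

theorem connectionMatrix_torsion_mulVec (z u v : Idx n p q → ℝ) :
    connectionMatrix (torsion g e z) u *ᵥ v = verticalLift (act
      (curvatureMatrix (baseChristoffel g e) (basePart z) (basePart u) (basePart v))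
      (fibrePart z)) := by
  let actOn : Matrix (Fin n) (Fin n) ℝ →ₗ[ℝ] Components n p q :=
    { toFun := fun φ => act φ (fibrePart z)
      map_add' := fun φ ψ => add_act φ ψ _
      map_smul' := fun r φ => smul_act r φ _ }
  have hsum : actOn (curvatureMatrix (baseChristoffel g e) (basePart z) (basePart u) (basePart v))
      = ∑ l, ∑ r, (basePart u l * basePart v r) • actOn (of fun k m =>
        curvature (baseChristoffel g e) (basePart z) l r m k) := by
    simp only [curvatureMatrix, map_sum, map_smul]
  change _ = verticalLift (actOn _)
  rw [hsum]
  funext c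
  rw [connectionMatrix_mulVec_apply]
  rcases c with c | ⟨i, j⟩
  · simp [torsion, verticalLift, mkIdx]
  · simp only [Fintype.sum_sum_type, torsion, zero_mul, Finset.sum_const_zero, add_zero,
      verticalLift, mkIdx, Sum.elim_inr, Finset.sum_apply]
    exact Finset.sum_congr rfl fun l _ => Finset.sum_congr rfl fun r _ => by
      rw [mul_assoc, mul_comm]
      rfl

/-- The covariant derivative, for the metric connection of the rescaled Sasaki type metric, of the
vector field with constant components `v` in the direction `u`, in terms of its horizontal and
vertical parts: the Levi-Civita connection of `f g` acts on the former, and the covariant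
derivative `∇` of tensors acts on the latter. -/
def adaptedConnection (g : Metric n M) (f : M → ℝ)
    (e : OpenPartialHomeomorph M (EuclideanSpace ℝ (Fin n))) (z u v : Idx n p q → ℝ) :
    Idx n p q → ℝ :=
  horizontalLift g e z
      (connectionMatrix (christoffel (scaledMatrix g f e) (basePart z)) (basePart u) *ᵥ basePart v)
    + verticalLift (act (matrixDeriv (fun y => connectionMatrix (baseChristoffel g e y)
          (basePart v)) (basePart z) (basePart u)) (fibrePart z)
        + act (connectionMatrix (baseChristoffel g e (basePart z)) (basePart v)) (fibrePart u)
        + connectionTerm g e (basePart z) (basePart u) (verticalPart g e z v))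

theorem basePart_adaptedConnection (z u v : Idx n p q → ℝ) :
    basePart (adaptedConnection g f e z u v) = connectionMatrix
      (christoffel (scaledMatrix g f e) (basePart z)) (basePart u) *ᵥ basePart v :=
  basePart_horizontalLift_add_verticalLift _ _ _

theorem verticalPart_adaptedConnection (z u v : Idx n p q → ℝ) :
    verticalPart g e z (adaptedConnection g f e z u v)
      = act (matrixDeriv (fun y => connectionMatrix (baseChristoffel g e y)
          (basePart v)) (basePart z) (basePart u)) (fibrePart z)
        + act (connectionMatrix (baseChristoffel g e (basePart z)) (basePart v)) (fibrePart u)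
        + connectionTerm g e (basePart z) (basePart u) (verticalPart g e z v) :=
  verticalPart_horizontalLift_add_verticalLift _ _ _

theorem adaptedConnection_metric (he : e ∈ IsManifold.maximalAtlas (𝓡 n) ∞ M)
    (hf : ContMDiff (𝓡 n) 𝓘(ℝ, ℝ) ∞ f) (hf₀ : ∀ y, f y ≠ 0) {z : Idx n p q → ℝ}
    (hz : basePart z ∈ coordDomain e) (u v w : Idx n p q → ℝ) :
    v ⬝ᵥ matrixDeriv (sasakiMatrix g f e) z u *ᵥ w
      = adaptedConnection g f e z u v ⬝ᵥ sasakiMatrix g f e z *ᵥ w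
        + v ⬝ᵥ sasakiMatrix g f e z *ᵥ adaptedConnection g f e z u w := by
  obtain ⟨X, rfl, hX⟩ := exists_curve_hasDerivAt z u
  have hbase := hasDerivAt_basePart hX
  have hvert (v : Idx n p q → ℝ) := hasDerivAt_verticalPart (g := g) he hz hX (hasDerivAt_const 0 v)
  have horizontal := hasDerivAt_dotProduct_metric_mulVec (G := scaledMatrix g f e)
    scaledMatrix_isSymm (isUnit_det_scaledMatrix he hf₀ hz)
    (fun a b => (contDiffAt_scaledMatrix he hf hz a b).differentiableAt (by simp)) hbase
    (hasDerivAt_const 0 (basePart v)) (hasDerivAt_const 0 (basePart w))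
  have vertical := hasDerivAt_tensorInner (g := g) he hz hbase (hvert v) (hvert w)
  refine dotProduct_matrixDeriv_mulVec_eq_of_hasDerivAt
    (fun a b => (contDiffAt_sasakiMatrix he hf hz a b).differentiableAt (by simp)) hX ?_
  simp only [dotProduct_sasakiMatrix_mulVec, sasaki_eq, basePart_adaptedConnection,
    verticalPart_adaptedConnection]
  refine (horizontal.add vertical).congr_deriv ?_
  have hb : basePart (0 : Idx n p q → ℝ) = 0 := rfl
  have hf : fibrePart (0 : Idx n p q → ℝ) = 0 := rfl
  simp only [zero_add, hb, hf, map_zero, add_zero]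
  ring

theorem adaptedConnection_torsion (he : e ∈ IsManifold.maximalAtlas (𝓡 n) ∞ M)
    {z : Idx n p q → ℝ} (hz : basePart z ∈ coordDomain e) (u v : Idx n p q → ℝ) :
    adaptedConnection g f e z u v - adaptedConnection g f e z v u
      = connectionMatrix (torsion g e z) u *ᵥ v := by
  rw [connectionMatrix_torsion_mulVec, sub_eq_iff_eq_add,
    curvatureMatrix_eq (differentiableAt_baseChristoffel he hz)]
  refine eq_of_basePart_eq_of_verticalPart_eq (g := g) (e := e) (z := z) ?_ ?_
  · rw [basePart_adaptedConnection,
      connectionMatrix_christoffel_mulVec_comm (fun _ => scaledMatrix_isSymm _),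
      ← basePart_adaptedConnection]
    exact (zero_add _).symm
  · have hvert (u v : Idx n p q → ℝ) : verticalPart g e z (adaptedConnection g f e z u v)
        = act (matrixDeriv (fun y => connectionMatrix (baseChristoffel g e y) (basePart v))
            (basePart z) (basePart u)) (fibrePart z)
          + act (connectionMatrix (baseChristoffel g e (basePart z)) (basePart v)) (fibrePart u)
          + (act (connectionMatrix (baseChristoffel g e (basePart z)) (basePart u)) (fibrePart v)
            + act (connectionMatrix (baseChristoffel g e (basePart z)) (basePart u))
              (act (connectionMatrix (baseChristoffel g e (basePart z)) (basePart v))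
                (fibrePart z))) := by
      rw [verticalPart_adaptedConnection, ← act_add]
      rfl
    rw [verticalPart_add, verticalPart_verticalLift, hvert u v, hvert v u, add_act, sub_act,
      ← act_commutator]
    abel

theorem connectionMatrix_bundleConnection_mulVec (he : e ∈ IsManifold.maximalAtlas (𝓡 n) ∞ M)
    (hf : ContMDiff (𝓡 n) 𝓘(ℝ, ℝ) ∞ f) (hf₀ : ∀ y, f y ≠ 0) {z : Idx n p q → ℝ}
    (hz : basePart z ∈ coordDomain e) (u v : Idx n p q → ℝ) :
    connectionMatrix (bundleConnection g f e p q z) u *ᵥ v = adaptedConnection g f e z u v :=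
  connectionMatrix_metricConnection_unique sasakiMatrix_isSymm torsion_antisymm
    (isUnit_det_sasakiMatrix he hf₀ hz) (adaptedConnection_metric he hf hf₀ hz)
    (adaptedConnection_torsion he hz) u v

/-- The second covariant derivative `δ²t/ds²` along the curve `x`, for `X = (x, t)` in induced
coordinates, the first one being the vertical part of `X'`. -/
def secondCovDeriv (g : Metric n M) (e : OpenPartialHomeomorph M (EuclideanSpace ℝ (Fin n)))
    (X : ℝ → Idx n p q → ℝ) (t : ℝ) : Components n p q :=
  deriv (fun s => verticalPart g e (X s) (deriv X s)) t
    + connectionTerm g e (basePart (X t)) (basePart (deriv X t))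
      (verticalPart g e (X t) (deriv X t))

theorem deriv_basePart {X : ℝ → Idx n p q → ℝ} {t : ℝ} (hX : DifferentiableAt ℝ X t) :
    deriv (fun s => basePart (X s)) t = basePart (deriv X t) :=
  (hasDerivAt_basePart hX.hasDerivAt).deriv

theorem contDiffAt_basePart {r : WithTop ℕ∞} {X : ℝ → Idx n p q → ℝ} {t : ℝ}
    (hX : ContDiffAt ℝ r X t) : ContDiffAt ℝ r (fun s => basePart (X s)) t :=
  contDiff_basePart.contDiffAt.comp t hX

theorem deriv_deriv_basePart {X : ℝ → Idx n p q → ℝ} {t : ℝ} (hX : ContDiffAt ℝ 2 X t) :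
    deriv (deriv fun s => basePart (X s)) t = basePart (deriv (deriv X) t) :=
  (Filter.EventuallyEq.deriv_eq ((eventually_differentiableAt hX).mono
    fun _ hs => deriv_basePart hs)).trans
    (deriv_basePart (hasDerivAt_deriv_of_contDiffAt hX).differentiableAt)

theorem basePart_acceleration (he : e ∈ IsManifold.maximalAtlas (𝓡 n) ∞ M)
    (hf : ContMDiff (𝓡 n) 𝓘(ℝ, ℝ) ∞ f) (hf₀ : ∀ y, f y ≠ 0) {X : ℝ → Idx n p q → ℝ} {t : ℝ}
    (ht : basePart (X t) ∈ coordDomain e) (hX : ContDiffAt ℝ 2 X t) :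
    basePart (acceleration (bundleConnection g f e p q) X t)
      = acceleration (christoffel (scaledMatrix g f e)) (fun s => basePart (X s)) t := by
  rw [acceleration, acceleration, connectionMatrix_bundleConnection_mulVec he hf hf₀ ht,
    deriv_deriv_basePart hX, deriv_basePart (hX.differentiableAt two_ne_zero),
    ← basePart_adaptedConnection]
  rfl

theorem verticalPart_acceleration (he : e ∈ IsManifold.maximalAtlas (𝓡 n) ∞ M)
    (hf : ContMDiff (𝓡 n) 𝓘(ℝ, ℝ) ∞ f) (hf₀ : ∀ y, f y ≠ 0) {X : ℝ → Idx n p q → ℝ} {t : ℝ}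
    (ht : basePart (X t) ∈ coordDomain e) (hX : ContDiffAt ℝ 2 X t) :
    verticalPart g e (X t) (acceleration (bundleConnection g f e p q) X t)
      = secondCovDeriv g e X t := by
  have hderiv := hasDerivAt_verticalPart (g := g) he ht
    (hX.differentiableAt two_ne_zero).hasDerivAt (hasDerivAt_deriv_of_contDiffAt hX)
  rw [acceleration, connectionMatrix_bundleConnection_mulVec he hf hf₀ ht, verticalPart_add,
    verticalPart_adaptedConnection, secondCovDeriv, hderiv.deriv, verticalPart_eq, add_act]
  abel

theorem geodesicEquation_bundleConnection_iff (he : e ∈ IsManifold.maximalAtlas (𝓡 n) ∞ M)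
    (hf : ContMDiff (𝓡 n) 𝓘(ℝ, ℝ) ∞ f) (hf₀ : ∀ y, f y ≠ 0) {X : ℝ → Idx n p q → ℝ} {t : ℝ}
    (ht : basePart (X t) ∈ coordDomain e) (hX : ContDiffAt ℝ 2 X t) :
    GeodesicEquation (bundleConnection g f e p q) X t ↔
      GeodesicEquation (christoffel (scaledMatrix g f e)) (fun s => basePart (X s)) t
        ∧ secondCovDeriv g e X t = 0 := by
  rw [geodesicEquation_iff _ hX, geodesicEquation_iff _ (contDiffAt_basePart hX),
    ← basePart_acceleration he hf hf₀ ht hX, ← verticalPart_acceleration he hf hf₀ ht hX]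
  refine ⟨fun h => h ▸ ⟨rfl, verticalPart_zero _⟩, fun ⟨hb, hv⟩ => ?_⟩
  exact eq_of_basePart_eq_of_verticalPart_eq hb (hv.trans (verticalPart_zero _).symm)

end BundleConnection

/-! ### Geodesics of the tensor bundle -/

section CovDeriv

open Topology

variable {n p q : ℕ} {M : Type*} [TopologicalSpace M]
  [ChartedSpace (EuclideanSpace ℝ (Fin n)) M] [IsManifold (𝓡 n) ∞ M] {g : Metric n M}
  {e : OpenPartialHomeomorph M (EuclideanSpace ℝ (Fin n))}

theorem covDeriv_eq {γ : ℝ → M} {A : ℝ → Components n p q} {t : ℝ}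
    (hγ : DifferentiableAt ℝ (fun s => coord e (γ s)) t) (hA : DifferentiableAt ℝ A t) :
    covDeriv g e γ A t = deriv A t
      + connectionTerm g e (coord e (γ t)) (deriv (fun s => coord e (γ s)) t) (A t) := by
  funext i j
  have h_base : (fun l => deriv (fun s => coord e (γ s) l) t) = deriv (fun s => coord e (γ s)) t :=
    funext fun l => deriv_apply hγ l
  have h_tensor : deriv (fun s => A s i j) t = deriv A t i j :=
    (hasDerivAt_pi.1 (hasDerivAt_pi.1 hA.hasDerivAt i) j).deriv
  rw [covDeriv, h_base, h_tensor, Pi.add_apply, Pi.add_apply]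

theorem covDeriv_components {c : ℝ → TensorBundle n M p q} {t : ℝ}
    (hc : DifferentiableAt ℝ (fun s => bundleCoord e (c s)) t) :
    covDeriv g e (fun s => proj (c s)) (fun s => components e (c s)) t
      = verticalPart g e (bundleCoord e (c t)) (deriv (fun s => bundleCoord e (c s)) t) := by
  have h_base : HasDerivAt (fun s => coord e (proj (c s))) _ t := hasDerivAt_basePart hc.hasDerivAt
  have h_fibre : HasDerivAt (fun s => components e (c s)) _ t := hasDerivAt_fibrePart hc.hasDerivAt
  rw [covDeriv_eq h_base.differentiableAt h_fibre.differentiableAt, h_base.deriv, h_fibre.deriv]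
  rfl

theorem covDeriv_covDeriv_components (he : e ∈ IsManifold.maximalAtlas (𝓡 n) ∞ M)
    {c : ℝ → TensorBundle n M p q} {t : ℝ} (ht : proj (c t) ∈ e.source)
    (hc : ContDiffAt ℝ 2 (fun s => bundleCoord e (c s)) t) :
    covDeriv g e (fun s => proj (c s))
        (covDeriv g e (fun s => proj (c s)) (fun s => components e (c s))) t
      = secondCovDeriv g e (fun s => bundleCoord e (c s)) t := by
  have h_dom : basePart (bundleCoord e (c t)) ∈ coordDomain e := coord_mem_coordDomain ht
  have hc' := hc.differentiableAt two_ne_zero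
  have h_base : HasDerivAt (fun s => coord e (proj (c s))) _ t :=
    hasDerivAt_basePart hc'.hasDerivAt
  have h_first : covDeriv g e (fun s => proj (c s)) (fun s => components e (c s)) =ᶠ[𝓝 t]
      fun s => verticalPart g e (bundleCoord e (c s)) (deriv (fun s => bundleCoord e (c s)) s) :=
    (eventually_differentiableAt hc).mono fun s hs => covDeriv_components hs
  have h_vertical := hasDerivAt_verticalPart (g := g) he h_dom hc'.hasDerivAt
    (hasDerivAt_deriv_of_contDiffAt hc)
  rw [covDeriv_eq h_base.differentiableAt
    (h_first.differentiableAt_iff.2 h_vertical.differentiableAt), h_first.deriv_eq,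
    h_first.eq_of_nhds, h_base.deriv]
  rfl

end CovDeriv

section Projection

variable {n p q : ℕ} {M : Type*} [TopologicalSpace M]
  [ChartedSpace (EuclideanSpace ℝ (Fin n)) M] [IsManifold (𝓡 n) ∞ M]
  {g : Metric n M} {f : M → ℝ} {J : Set ℝ} {c : ℝ → TensorBundle n M p q}

theorem hasVanishingSecondCovDeriv_of_isBundleGeodesic (hf : ContMDiff (𝓡 n) 𝓘(ℝ, ℝ) ∞ f)
    (hf₀ : ∀ y, f y ≠ 0) (hc : IsBundleGeodesic g f J c) :
    HasVanishingSecondCovDeriv g J c := fun e he t ht hsrc => by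
  obtain ⟨h_smooth, h_geodesic⟩ := hc.2.2.2 e he t ht hsrc
  have h_dom : basePart (bundleCoord e (c t)) ∈ coordDomain e := coord_mem_coordDomain hsrc
  rw [covDeriv_covDeriv_components he hsrc h_smooth]
  exact ((geodesicEquation_bundleConnection_iff he hf hf₀ h_dom h_smooth).1 h_geodesic).2

theorem isGeodesic_of_isBundleGeodesic {C : ℝ} (hC₀ : C ≠ 0)
    (hc : IsBundleGeodesic g (fun _ => C) J c) : IsGeodesic g J (fun t => proj (c t)) := by
  refine ⟨hc.1, hc.2.1, hc.2.2.1, fun e he t ht hsrc => ?_⟩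
  obtain ⟨h_smooth, h_geodesic⟩ := hc.2.2.2 e he t ht hsrc
  have h_dom : basePart (bundleCoord e (c t)) ∈ coordDomain e := coord_mem_coordDomain hsrc
  have h_base := ((geodesicEquation_bundleConnection_iff he contMDiff_const (fun _ => hC₀) h_dom
    h_smooth).1 h_geodesic).1
  have h_christoffel : christoffel (scaledMatrix g (fun _ => C) e) (coord e (proj (c t)))
      = baseChristoffel g e (coord e (proj (c t))) :=
    christoffel_const_smul hC₀ _ (isUnit_det_metricMatrix g he h_dom)
  refine ⟨contDiffAt_basePart h_smooth, fun k => ?_⟩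
  rw [← h_christoffel]
  exact h_base k

end Projection

section ZeroSection

open Matrix Topology

variable {n p q : ℕ} {M : Type*} [TopologicalSpace M]
  [ChartedSpace (EuclideanSpace ℝ (Fin n)) M]

/-- The zero section of `T^p_q(M)`. Along it the tensor component of a curve is parallel, so it
lifts the geodesics of `f g` to geodesics of the tensor bundle. -/
def zeroSection (p q : ℕ) (y : M) : TensorBundle n M p q := ⟨y, 0⟩

theorem bundleCoord_zeroSection (e : OpenPartialHomeomorph M (EuclideanSpace ℝ (Fin n))) (y : M) :
    bundleCoord e (zeroSection p q y) = mkIdx (coord e y) 0 := rfl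

theorem contDiff_mkIdx_zero {r : WithTop ℕ∞} :
    ContDiff ℝ r fun x : Fin n → ℝ => (mkIdx x 0 : Idx n p q → ℝ) :=
  contDiff_pi.2 fun a => match a with
    | Sum.inl i => contDiff_apply ℝ ℝ i
    | Sum.inr _ => contDiff_const

theorem hasDerivAt_mkIdx_zero {x : ℝ → Fin n → ℝ} {v : Fin n → ℝ} {t : ℝ}
    (hx : HasDerivAt x v t) :
    HasDerivAt (fun s => (mkIdx (x s) 0 : Idx n p q → ℝ)) (mkIdx v 0) t :=
  hasDerivAt_pi.2 fun a => match a with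
    | Sum.inl i => hasDerivAt_pi.1 hx i
    | Sum.inr _ => hasDerivAt_const t 0

variable [IsManifold (𝓡 n) ∞ M] {g : Metric n M} {f : M → ℝ}
  {e e' : OpenPartialHomeomorph M (EuclideanSpace ℝ (Fin n))}

theorem verticalPart_mkIdx_zero (x v : Fin n → ℝ) :
    verticalPart g e (mkIdx x 0 : Idx n p q → ℝ) (mkIdx v 0) = 0 := by
  rw [verticalPart_eq, fibrePart_mkIdx, fibrePart_mkIdx, act_zero, add_zero]

theorem secondCovDeriv_mkIdx_zero {x : ℝ → Fin n → ℝ} {t : ℝ} (hx : ContDiffAt ℝ 2 x t) :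
    secondCovDeriv g e (fun s => (mkIdx (x s) 0 : Idx n p q → ℝ)) t = 0 := by
  have h_deriv := (eventually_differentiableAt hx).mono fun s hs =>
    (hasDerivAt_mkIdx_zero (p := p) (q := q) hs.hasDerivAt).deriv
  have h_vertical : (fun s => verticalPart g e (mkIdx (x s) 0 : Idx n p q → ℝ)
      (deriv (fun s => (mkIdx (x s) 0 : Idx n p q → ℝ)) s)) =ᶠ[𝓝 t] fun _ => 0 :=
    h_deriv.mono fun s hs => by simp only [hs, verticalPart_mkIdx_zero]
  rw [secondCovDeriv, h_vertical.deriv_eq, h_vertical.eq_of_nhds, deriv_const, zero_add]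
  exact act_zero _

theorem sasaki_mkIdx_zero (x v : Fin n → ℝ) :
    sasaki g f e (mkIdx x 0 : Idx n p q → ℝ) (mkIdx v 0) (mkIdx v 0)
      = v ⬝ᵥ scaledMatrix g f e x *ᵥ v := by
  rw [sasaki_eq, verticalPart_mkIdx_zero, basePart_mkIdx, basePart_mkIdx]
  simp [tensorInner]

theorem eventually_dotProduct_scaledMatrix_mulVec_transition
    (he : e ∈ IsManifold.maximalAtlas (𝓡 n) ∞ M) (he' : e' ∈ IsManifold.maximalAtlas (𝓡 n) ∞ M)
    {x : Fin n → ℝ} (hx : x ∈ coordDomain e) (hx' : point e x ∈ e'.source) :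
    ∀ᶠ y in 𝓝 x, ∀ v w, v ⬝ᵥ scaledMatrix g f e y *ᵥ w
      = fderiv ℝ (transition e e') y v ⬝ᵥ scaledMatrix g f e' (transition e e' y) *ᵥ
        fderiv ℝ (transition e e') y w :=
  ((isOpen_transition_source e e').eventually_mem ⟨hx, hx'⟩).mono fun y hy v w => by
    rw [dotProduct_scaledMatrix_mulVec, dotProduct_scaledMatrix_mulVec, point_transition hy.2,
      dotProduct_metricMatrix_mulVec_transition g he he' hy.1 hy.2]

theorem acceleration_transition (he : e ∈ IsManifold.maximalAtlas (𝓡 n) ∞ M)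
    (he' : e' ∈ IsManifold.maximalAtlas (𝓡 n) ∞ M) (hf : ContMDiff (𝓡 n) 𝓘(ℝ, ℝ) ∞ f)
    (hf₀ : ∀ y, f y ≠ 0) {x : ℝ → Fin n → ℝ} {t : ℝ} (hx : ContDiffAt ℝ 2 x t)
    (ht : x t ∈ coordDomain e) (ht' : point e (x t) ∈ e'.source) :
    acceleration (christoffel (scaledMatrix g f e')) (fun s => transition e e' (x s)) t
      = fderiv ℝ (transition e e') (x t)
        (acceleration (christoffel (scaledMatrix g f e)) x t) :=
  have h_dom' := transition_mem_coordDomain ht'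
  acceleration_christoffel_comp scaledMatrix_isSymm scaledMatrix_isSymm
    (isUnit_det_scaledMatrix he hf₀ ht) (isUnit_det_scaledMatrix he' hf₀ h_dom')
    (fun a b => (contDiffAt_scaledMatrix he hf ht a b).differentiableAt (by simp))
    (fun a b => (contDiffAt_scaledMatrix he' hf h_dom' a b).differentiableAt (by simp))
    ((contDiffAt_transition he he' ht ht').of_le ENat.LEInfty.out) hx
    (eventually_dotProduct_scaledMatrix_mulVec_transition he he' ht ht')

theorem isBundleGeodesic_zeroSection (he : e ∈ IsManifold.maximalAtlas (𝓡 n) ∞ M)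
    (hf : ContMDiff (𝓡 n) 𝓘(ℝ, ℝ) ∞ f) (hf₀ : ∀ y, f y ≠ 0) {J : Set ℝ} (hJ : IsOpen J)
    (hJ' : J.OrdConnected) {x : ℝ → Fin n → ℝ} (hdom : ∀ t ∈ J, x t ∈ coordDomain e)
    (hx : ∀ t ∈ J, ContDiffAt ℝ 2 x t)
    (hgeo : ∀ t ∈ J, acceleration (christoffel (scaledMatrix g f e)) x t = 0) :
    IsBundleGeodesic g f J fun s => zeroSection p q (point e (x s)) := by
  refine ⟨hJ, hJ', fun t ht => ?_, fun e' he' t ht ht' => ?_⟩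
  · exact (ContinuousAt.comp (f := fun s => (WithLp.toLp 2 (x s) : EuclideanSpace ℝ (Fin n)))
      (e.continuousAt_symm (hdom t ht))
      ((PiLp.continuous_toLp 2 _).continuousAt.comp (hx t ht).continuousAt)).continuousWithinAt
  have h_source : point e (x t) ∈ e'.source := ht'
  have h_dom : basePart (bundleCoord e' (zeroSection p q (point e (x t)))) ∈ coordDomain e' :=
    transition_mem_coordDomain h_source
  have h_base : ContDiffAt ℝ 2 (fun s => transition e e' (x s)) t :=
    ((contDiffAt_transition he he' (hdom t ht) h_source).of_le ENat.LEInfty.out).comp t (hx t ht)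
  have h_smooth : ContDiffAt ℝ 2
      (fun s => bundleCoord e' (zeroSection p q (point e (x s)))) t :=
    contDiff_mkIdx_zero.contDiffAt.comp t h_base
  refine ⟨h_smooth, (geodesicEquation_bundleConnection_iff he' hf hf₀ h_dom h_smooth).2
    ⟨(geodesicEquation_iff _ h_base).2 ?_, secondCovDeriv_mkIdx_zero h_base⟩⟩
  rw [acceleration_transition he he' hf hf₀ (hx t ht) (hdom t ht) h_source, hgeo t ht, map_zero]

theorem isUnitSpeed_zeroSection (he : e ∈ IsManifold.maximalAtlas (𝓡 n) ∞ M) {J : Set ℝ}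
    {x : ℝ → Fin n → ℝ} (hdom : ∀ t ∈ J, x t ∈ coordDomain e)
    (hx : ∀ t ∈ J, DifferentiableAt ℝ x t)
    (hspeed : ∀ t ∈ J, deriv x t ⬝ᵥ scaledMatrix g f e (x t) *ᵥ deriv x t = 1) :
    IsUnitSpeed g f J fun s => zeroSection p q (point e (x s)) := fun e' he' t ht ht' => by
  have h_base : HasDerivAt (fun s => transition e e' (x s))
      (fderiv ℝ (transition e e') (x t) (deriv x t)) t :=
    ((contDiffAt_transition he he' (hdom t ht) ht').differentiableAt
      (by simp)).hasFDerivAt.comp_hasDerivAt t (hx t ht).hasDerivAt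
  have h_total : HasDerivAt (fun s => bundleCoord e' (zeroSection p q (point e (x s)))) _ t :=
    hasDerivAt_mkIdx_zero h_base
  have h_velocity := funext fun a => (hasDerivAt_pi.1 h_total a).deriv
  rw [h_velocity, bundleCoord_zeroSection, sasaki_mkIdx_zero, ← hspeed t ht]
  exact ((eventually_dotProduct_scaledMatrix_mulVec_transition he he' (hdom t ht)
    ht').self_of_nhds _ _).symm

end ZeroSection

section Rigidity

open Matrix Set Topology

section Energy

variable {κ : Type*} [Fintype κ] [DecidableEq κ] {G : (κ → ℝ) → Matrix κ κ ℝ}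

theorem hasDerivAt_energy_of_acceleration_eq_zero (hsymm : ∀ z, (G z).IsSymm) {x : ℝ → κ → ℝ}
    {t : ℝ} (hdet : IsUnit (G (x t)).det) (hG : ∀ a b, ContDiffAt ℝ ∞ (fun w => G w a b) (x t))
    (hx : ContDiffAt ℝ 2 x t) (h : acceleration (christoffel G) x t = 0) :
    HasDerivAt (fun s => deriv x s ⬝ᵥ G (x s) *ᵥ deriv x s) 0 t := by
  simpa only [h, zero_dotProduct, mul_zero] using
    hasDerivAt_energy hsymm hdet (fun a b => (hG a b).differentiableAt (by simp)) hx

theorem exists_geodesic_dotProduct_eq {U : Set (κ → ℝ)} (hU : IsOpen U)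
    (hsymm : ∀ z, (G z).IsSymm) (hdet : ∀ z ∈ U, IsUnit (G z).det)
    (hG : ∀ z ∈ U, ∀ a b, ContDiffAt ℝ ∞ (fun w => G w a b) z) {x₀ : κ → ℝ} (hx₀ : x₀ ∈ U)
    (ξ : κ → ℝ) :
    ∃ ε > 0, ∃ x : ℝ → κ → ℝ, x 0 = x₀ ∧ deriv x 0 = ξ ∧ ∀ t ∈ Ioo (-ε) ε, x t ∈ U ∧
      ContDiffAt ℝ 2 x t ∧ acceleration (christoffel G) x t = 0 ∧
      deriv x t ⬝ᵥ G (x t) *ᵥ deriv x t = ξ ⬝ᵥ G x₀ *ᵥ ξ := by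
  obtain ⟨ε, hε, x, rfl, rfl, hx⟩ := exists_acceleration_eq_zero hU
    (fun z hz c a b => (contDiffAt_christoffel (hG z hz) (hdet z hz) c a b).of_le (by simp)) hx₀ ξ
  have h_energy : ∀ t ∈ Ioo (-ε) ε,
      HasDerivAt (fun s => deriv x s ⬝ᵥ G (x s) *ᵥ deriv x s) 0 t := fun t ht =>
    have ⟨h_mem, h_smooth, h_geodesic⟩ := hx t ht
    hasDerivAt_energy_of_acceleration_eq_zero hsymm (hdet _ h_mem) (hG _ h_mem) h_smooth h_geodesic
  refine ⟨ε, hε, x, rfl, rfl, fun t ht => ⟨(hx t ht).1, (hx t ht).2.1, (hx t ht).2.2, ?_⟩⟩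
  exact isOpen_Ioo.is_const_of_deriv_eq_zero isPreconnected_Ioo
    (fun s hs => (h_energy s hs).differentiableAt.differentiableWithinAt)
    (fun s hs => (h_energy s hs).deriv) ht ⟨neg_lt_zero.2 hε, hε⟩

end Energy

variable {n : ℕ} {M : Type*} [TopologicalSpace M]
  [ChartedSpace (EuclideanSpace ℝ (Fin n)) M] [IsManifold (𝓡 n) ∞ M]
  {g : Metric n M} {f : M → ℝ} {e : OpenPartialHomeomorph M (EuclideanSpace ℝ (Fin n))}

theorem acceleration_congr {κ : Type*} [Fintype κ] (Γ : (κ → ℝ) → κ → κ → κ → ℝ)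
    {X Y : ℝ → κ → ℝ} {t : ℝ} (h : X =ᶠ[𝓝 t] Y) : acceleration Γ X t = acceleration Γ Y t := by
  rw [acceleration, acceleration, h.deriv.deriv_eq, h.deriv_eq, h.eq_of_nhds]

theorem fderiv_comp_point_apply_deriv_eq_zero (he : e ∈ IsManifold.maximalAtlas (𝓡 n) ∞ M)
    (hf : ContMDiff (𝓡 n) 𝓘(ℝ, ℝ) ∞ f) (hf₀ : ∀ y, f y ≠ 0) {x : ℝ → Fin n → ℝ} {t : ℝ}
    (ht : x t ∈ coordDomain e) (hx : ContDiffAt ℝ 2 x t) (hx' : deriv x t ≠ 0)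
    (hg : acceleration (baseChristoffel g e) x t = 0)
    (hfg : acceleration (christoffel (scaledMatrix g f e)) x t = 0) :
    fderiv ℝ (fun z => f (point e z)) (x t) (deriv x t) = 0 := by
  have energy_g := hasDerivAt_energy_of_acceleration_eq_zero (metricMatrix_isSymm g e)
    (isUnit_det_metricMatrix g he ht) (contDiffAt_metricMatrix g he ht) hx hg
  have energy_fg := hasDerivAt_energy_of_acceleration_eq_zero scaledMatrix_isSymm
    (isUnit_det_scaledMatrix he hf₀ ht) (contDiffAt_scaledMatrix he hf ht) hx hfg
  have h_factor : HasDerivAt (fun s => f (point e (x s)))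
      (fderiv ℝ (fun z => f (point e z)) (x t) (deriv x t)) t :=
    ((contDiffAt_comp_point hf he ht).differentiableAt (by simp)).hasFDerivAt.comp_hasDerivAt t
      (hx.differentiableAt two_ne_zero).hasDerivAt
  simp only [dotProduct_scaledMatrix_mulVec] at energy_fg
  have h_product := (h_factor.mul energy_g).unique energy_fg
  rw [mul_zero, add_zero] at h_product
  exact (mul_eq_zero.1 h_product).resolve_right
    (dotProduct_metricMatrix_mulVec_pos g he ht hx').ne'

theorem fderiv_comp_point_apply_eq_zero (p q : ℕ) (hf : ContMDiff (𝓡 n) 𝓘(ℝ, ℝ) ∞ f)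
    (hf₀ : ∀ y, f y ≠ 0)
    (h : ∀ (J : Set ℝ) (c : ℝ → TensorBundle n M p q), IsBundleGeodesic g f J c →
      IsUnitSpeed g f J c → IsGeodesic g J (fun t => proj (c t)))
    (he : e ∈ IsManifold.maximalAtlas (𝓡 n) ∞ M) {x₀ : Fin n → ℝ} (hx₀ : x₀ ∈ coordDomain e)
    {ξ : Fin n → ℝ} (hξ : ξ ⬝ᵥ scaledMatrix g f e x₀ *ᵥ ξ = 1) :
    fderiv ℝ (fun z => f (point e z)) x₀ ξ = 0 := by
  obtain ⟨ε, hε, x, rfl, rfl, hx⟩ := exists_geodesic_dotProduct_eq (isOpen_coordDomain e)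
    (G := scaledMatrix g f e) scaledMatrix_isSymm
    (fun _ hz => isUnit_det_scaledMatrix he hf₀ hz)
    (fun _ hz => contDiffAt_scaledMatrix he hf hz) hx₀ ξ
  have h_zero : (0 : ℝ) ∈ Ioo (-ε) ε := ⟨neg_lt_zero.2 hε, hε⟩
  have h_bundle := isBundleGeodesic_zeroSection (p := p) (q := q) he hf hf₀ isOpen_Ioo
    ordConnected_Ioo (fun t ht => (hx t ht).1) (fun t ht => (hx t ht).2.1)
    fun t ht => (hx t ht).2.2.1
  have h_speed := isUnitSpeed_zeroSection (p := p) (q := q) he (fun t ht => (hx t ht).1)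
    (fun t ht => (hx t ht).2.1.differentiableAt two_ne_zero)
    fun t ht => (hx t ht).2.2.2.trans hξ
  have h_coord : (fun s => coord e (point e (x s))) =ᶠ[𝓝 0] x :=
    (isOpen_Ioo.eventually_mem h_zero).mono fun s hs => coord_point (hx s hs).1
  obtain ⟨h_smooth, h_geodesic⟩ :=
    (h _ _ h_bundle h_speed).2.2.2 e he 0 h_zero (point_mem_source (hx 0 h_zero).1)
  have h_acc := (geodesicEquation_iff _ h_smooth).1 h_geodesic
  have h_ne : deriv x 0 ≠ 0 := fun h_deriv => by
    rw [h_deriv, zero_dotProduct] at hξ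
    exact zero_ne_one hξ
  exact fderiv_comp_point_apply_deriv_eq_zero he hf hf₀ hx₀ (hx 0 h_zero).2.1 h_ne
    ((acceleration_congr _ h_coord).symm.trans h_acc) (hx 0 h_zero).2.2.1

theorem fderiv_comp_point_eq_zero (hpos : ∀ y, 0 < f y)
    (he : e ∈ IsManifold.maximalAtlas (𝓡 n) ∞ M) {x : Fin n → ℝ} (hx : x ∈ coordDomain e)
    (h : ∀ ξ, ξ ⬝ᵥ scaledMatrix g f e x *ᵥ ξ = 1 → fderiv ℝ (fun z => f (point e z)) x ξ = 0) :
    fderiv ℝ (fun z => f (point e z)) x = 0 := by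
  ext1 η
  obtain rfl | hη := eq_or_ne η 0
  · exact map_zero _
  have h_len : 0 < η ⬝ᵥ scaledMatrix g f e x *ᵥ η := by
    rw [dotProduct_scaledMatrix_mulVec]
    exact mul_pos (hpos _) (dotProduct_metricMatrix_mulVec_pos g he hx hη)
  set r := √(η ⬝ᵥ scaledMatrix g f e x *ᵥ η) with hr
  have h_unit : (r⁻¹ • η) ⬝ᵥ scaledMatrix g f e x *ᵥ (r⁻¹ • η) = 1 := by
    rw [smul_dotProduct, mulVec_smul, dotProduct_smul, smul_smul, smul_eq_mul, ← mul_inv, hr,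
      Real.mul_self_sqrt h_len.le, inv_mul_cancel₀ h_len.ne']
  have h_scaled := h _ h_unit
  rw [map_smul, smul_eq_mul] at h_scaled
  exact (mul_eq_zero.1 h_scaled).resolve_left (inv_ne_zero (Real.sqrt_ne_zero'.2 h_len))

theorem isLocallyConstant_of_fderiv_comp_point_eq_zero (hf : ContMDiff (𝓡 n) 𝓘(ℝ, ℝ) ∞ f)
    (h : ∀ e ∈ IsManifold.maximalAtlas (𝓡 n) ∞ M, ∀ x ∈ coordDomain e,
      fderiv ℝ (fun z => f (point e z)) x = 0) : IsLocallyConstant f := by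
  refine (IsLocallyConstant.iff_eventually_eq f).2 fun y => ?_
  set e := chartAt (EuclideanSpace ℝ (Fin n)) y
  have he : e ∈ IsManifold.maximalAtlas (𝓡 n) ∞ M := IsManifold.chart_mem_maximalAtlas y
  have hy : y ∈ e.source := mem_chart_source _ y
  obtain ⟨δ, hδ, h_ball⟩ := Metric.isOpen_iff.1 (isOpen_coordDomain e) (coord e y)
    (coord_mem_coordDomain hy)
  have h_cont : ContinuousAt (coord e) y :=
    (PiLp.continuous_ofLp 2 _).continuousAt.comp (e.continuousAt hy)
  have h_const : ∀ z ∈ Metric.ball (coord e y) δ, f (point e z) = f (point e (coord e y)) :=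
    fun z hz => Metric.isOpen_ball.is_const_of_fderiv_eq_zero (𝕜 := ℝ)
      (convex_ball _ _).isPreconnected
      (fun z hz => ((contDiffAt_comp_point hf he (h_ball hz)).differentiableAt
        (by simp)).differentiableWithinAt)
      (fun z hz => h e he z (h_ball hz)) hz (Metric.mem_ball_self hδ)
  filter_upwards [e.open_source.mem_nhds hy, h_cont.preimage_mem_nhds (Metric.ball_mem_nhds _ hδ)]
    with w hw hw'
  simpa only [point_coord hw, point_coord hy] using h_const _ hw'

theorem exists_eq_const_of_isGeodesic [ConnectedSpace M] (p q : ℕ)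
    (hf : ContMDiff (𝓡 n) 𝓘(ℝ, ℝ) ∞ f) (hpos : ∀ y, 0 < f y)
    (h : ∀ (J : Set ℝ) (c : ℝ → TensorBundle n M p q), IsBundleGeodesic g f J c →
      IsUnitSpeed g f J c → IsGeodesic g J (fun t => proj (c t))) : ∃ C, ∀ y, f y = C :=
  have h_loc := isLocallyConstant_of_fderiv_comp_point_eq_zero hf fun _ he _ hx =>
    fderiv_comp_point_eq_zero (g := g) hpos he hx fun _ hξ =>
      fderiv_comp_point_apply_eq_zero p q hf (fun y => (hpos y).ne') h he hx hξ
  have ⟨y₀⟩ := ‹ConnectedSpace M›.toNonempty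
  ⟨f y₀, fun y => h_loc.apply_eq_of_preconnectedSpace y y₀⟩

end Rigidity

end RescaledSasaki

end

theorem mainTheorem12 {n : ℕ} {M : Type*} [TopologicalSpace M]
    [ChartedSpace (EuclideanSpace ℝ (Fin n)) M] [IsManifold (𝓡 n) ∞ M] [ConnectedSpace M]
    (g : RescaledSasaki.Metric n M) (f : M → ℝ) (hf : ContMDiff (𝓡 n) 𝓘(ℝ, ℝ) ∞ f)
    (hpos : ∀ x, 0 < f x) (p q : ℕ) :
    (∀ (J : Set ℝ) (c : ℝ → RescaledSasaki.TensorBundle n M p q),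
      RescaledSasaki.IsBundleGeodesic g f J c →
        RescaledSasaki.HasVanishingSecondCovDeriv g J c) ∧
    ((∀ (J : Set ℝ) (c : ℝ → RescaledSasaki.TensorBundle n M p q),
      RescaledSasaki.IsBundleGeodesic g f J c →
        RescaledSasaki.IsGeodesic g J (fun t => RescaledSasaki.proj (c t))) ↔
      ∃ C : ℝ, ∀ x, f x = C) ∧
    ((∀ (J : Set ℝ) (c : ℝ → RescaledSasaki.TensorBundle n M p q),
      RescaledSasaki.IsBundleGeodesic g f J c → RescaledSasaki.IsUnitSpeed g f J c →
        RescaledSasaki.IsGeodesic g J (fun t => RescaledSasaki.proj (c t))) ↔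
      ∃ C : ℝ, ∀ x, f x = C) := by
  have base_geodesic (h : ∃ C : ℝ, ∀ x, f x = C) (J : Set ℝ)
      (c : ℝ → RescaledSasaki.TensorBundle n M p q) (hc : RescaledSasaki.IsBundleGeodesic g f J c) :
      RescaledSasaki.IsGeodesic g J (fun t => RescaledSasaki.proj (c t)) := by
    obtain ⟨C, hC⟩ := h
    obtain rfl : f = fun _ => C := funext hC
    obtain ⟨y⟩ := ‹ConnectedSpace M›.toNonempty
    exact RescaledSasaki.isGeodesic_of_isBundleGeodesic (hpos y).ne' hc
  refine ⟨fun J c hc => ?_, ⟨fun h => ?_, base_geodesic⟩,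
    ⟨fun h => ?_, fun h J c hc _ => base_geodesic h J c hc⟩⟩
  · exact RescaledSasaki.hasVanishingSecondCovDeriv_of_isBundleGeodesic hf
      (fun y => (hpos y).ne') hc
  · exact RescaledSasaki.exists_eq_const_of_isGeodesic p q hf hpos fun J c hc _ => h J c hc
  · exact RescaledSasaki.exists_eq_const_of_isGeodesic p q hf hpos h
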